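/- **Setting.** Let $A_1,\dots,A_d$ be pairwise (strongly) commuting self-adjoint operators on a complex Hilbert space, and let $\Lambda\subset\mathbb R^d$ be their joint spectrum, i.e. the set of $a=(a^1,\dots,a^d)$ for which there is $\psi\ne0$ with $A_j\psi=a^j\psi$ for all $j$. Assume $\Lambda\subset(\mathbb Z^d+\kappa)\cap\mathcal C$ for some $\kappa\in\mathbb R^d$ and some closed convex cone $\mathcal C\subseteq\mathbb R^d$ (with $0\in\mathcal C$). A function $h_0$ is *steep* in a bounded connected nonempty open set $\mathcal U\subset\mathbb R^d$ if $h_0\in C^1(\mathcal U)$, $\inf_{\mathcal U}\|\nabla h_0\|>0$, and there are $\mathtt r>0$, numbers $\alpha_1,\dots,\alpha_{d-1}$ and $\mathtt B_1,\dots,\mathtt B_{d-1}>0$ such that for all $a\in\mathcal U$, all $s=1,\dots,d-1$, all $s$-dimensional linear subspaces $V\perp\nabla h_0(a)$ and all $\xi\in(0,\mathtt r]$ there is $\eta\in[0,\xi]$ with $\|\Pi_V\nabla h_0(a+\eta u)\|\ge \mathtt B_s\xi^{\alpha_s}$ for all $u\in V$ with $\|u\|=1$ and $a+\eta u\in\mathcal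 U$ ($\Pi_V$ is the orthogonal projector on $V$). Assumption (L): $h_L\in C^\infty(\mathbb R^d;\mathbb R)$ coincides outside some ball with a function $h_0$ which is positively homogeneous of degree $\mathtt d>1$ on $\mathbb R^d\setminus\{0\}$, and $h_0$ is steep in an open set $\mathcal U\subset\{\frac12<\|a\|<1\}$ with $\mathcal C\cap\mathcal U=\mathcal C\cap\{\frac12<\|a\|<1\}$. Put $w=\nabla h_L$ and $\omega_a=h_L(a)$. Given $\delta,\mu,\mathtt R$, a point $a$ is *resonant with* $k\in\mathbb Z^d$ if $$|w(a)\cdot k|<\|a\|^\delta\|k\|,\qquad \|k\|\le\|a\|^\mu,\qquad \|a\|\ge\mathtt R$$ (so that $k\neq0$). A *module* is a subset $M\subseteq\mathbb Z^d$ with $\mathrm{span}_{\mathbb R}(M)\cap\mathbb Z^d=M$, and $\dim M$ is the dimension of its real span. **Theorem.** Under (L) there exist $0<\delta_0<\mathtt d-1$ and $\mathtt R_0>0$ such that for every $\delta\in(\delta_0,\mathtt d-1)$ there is $\mu_0>0$ such that, for all $0<\mu<\mu_0$ and all $\mathtt R>\mathtt R_0$, $\Lambda$ is a disjoint union $$\Lambda=\bigcup_{s=0}^d\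 \bigcup_{M\text{ module},\ \dim M=s}\ \bigcup_{j\in\mathbb N}E^{(s)}_{M,j}$$ (some blocks may be empty) with the following properties. (i) The blocks are dyadic: there is $C>0$ such that $\|a\|\le C\|b\|$ for all $a,b$ in the same block. (ii) If $s\ge1$, each $a\in E^{(s)}_{M,j}$ is resonant with some $k\in M$, while each nonempty block $E^{(0)}_{M,j}$ contains a point that is resonant with no $k\in\mathbb Z^d$. If $a\in E^{(s)}_{M,j}$ is resonant with $k\in\mathbb Z^d$ and $a+k\in\Lambda$, then $a+k\in E^{(s)}_{M,j}$. (iii) There is $K>0$ such that, for $a\in E^{(s)}_{M,j}$ and $b\in E^{(s')}_{M',j'}$ with $(s,M,j)\ne(s',M',j')$, $$\|a-b\|+|\omega_a-\omega_b|\ge K\left(\|a\|^\mu+\|b\|^\mu\right).$$ -/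

import Mathlib

open scoped ContDiff

/-- The joint spectrum of a family of (partially defined, linear) operators on a Hilbert space:
the `a ∈ ℝ^d` for which there is `ψ ≠ 0` in all the domains with `A_j ψ = a_j ψ` for all `j`. -/
def jointSpectrum {d : ℕ} {H : Type*} [NormedAddCommGroup H] [InnerProductSpace ℂ H]
    (A : Fin d → (H →ₗ.[ℂ] H)) : Set (EuclideanSpace ℝ (Fin d)) :=
  {a | ∃ ψ : H, ψ ≠ 0 ∧ ∀ j, (ψ, ((a j : ℝ) : ℂ) • ψ) ∈ (A j).graph}

/-- Two self-adjoint operators commute (in the strong sense) when their resolvents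
`(A + i)⁻¹` and `(B + i)⁻¹` commute: if `u = (A + i)⁻¹ f`, `v = (B + i)⁻¹ u`,
`p = (B + i)⁻¹ f` and `q = (A + i)⁻¹ p`, then `v = q`. -/
def ResolventsCommute {H : Type*} [NormedAddCommGroup H] [InnerProductSpace ℂ H]
    (A B : H →ₗ.[ℂ] H) : Prop :=
  ∀ f u v p q : H,
    (u, f - Complex.I • u) ∈ A.graph → (v, u - Complex.I • v) ∈ B.graph →
    (p, f - Complex.I • p) ∈ B.graph → (q, p - Complex.I • q) ∈ A.graph → v = q

/-- An integer vector, seen in `ℝ^d` with its Euclidean norm. -/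
def intVec {d : ℕ} (k : Fin d → ℤ) : EuclideanSpace ℝ (Fin d) :=
  WithLp.toLp 2 (fun i => (k i : ℝ))

/-- The operator-theoretic properties of a set of quantum actions: the `A_j` are self-adjoint,
they commute pairwise, and their joint spectrum lies in `(ℤ^d + κ) ∩ 𝒞`, for a vector `κ` and a
closed convex cone `𝒞`. (No pseudodifferential structure is required, so that the notion
covers more families than those of pseudodifferential operators.) -/
structure IsQuantumActions {d : ℕ} {H : Type*} [NormedAddCommGroup H] [InnerProductSpace ℂ H]
    [CompleteSpace H] (A : Fin d → (H →ₗ.[ℂ] H)) (κ : EuclideanSpace ℝ (Fin d))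
    (𝒞 : ProperCone ℝ (EuclideanSpace ℝ (Fin d))) : Prop where
  selfAdjoint : ∀ j, IsSelfAdjoint (A j)
  commute : ∀ i j, ResolventsCommute (A i) (A j)
  lattice : ∀ a ∈ jointSpectrum A, ∃ k : Fin d → ℤ, a = intVec k + κ
  cone : ∀ a ∈ jointSpectrum A, a ∈ 𝒞

/-- Steepness of `h` in the bounded connected nonempty open set `U`. The
steepness radius is `r`; the indices `α s` and coefficients `B s` matter for `1 ≤ s ≤ d - 1`
only. The max-min inequality
`max_{0 ≤ η ≤ ξ} min_{u ∈ M, ‖u‖ = 1, a + η u ∈ U} ‖Π_M ∇h(a + η u)‖ ≥ B_s ξ ^ α_s`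
is written with quantifiers. -/
def IsSteep {d : ℕ} (h : EuclideanSpace ℝ (Fin d) → ℝ)
    (U : Set (EuclideanSpace ℝ (Fin d))) : Prop :=
  IsOpen U ∧ IsConnected U ∧ Bornology.IsBounded U ∧ ContDiffOn ℝ 1 h U ∧
  (∃ c : ℝ, 0 < c ∧ ∀ a ∈ U, c ≤ ‖gradient h a‖) ∧
  ∃ (r : ℝ) (α B : ℕ → ℝ), 0 < r ∧ (∀ s, 1 ≤ s → s < d → 0 < B s) ∧
    ∀ a ∈ U, ∀ s : ℕ, 1 ≤ s → s < d →
      ∀ M : Submodule ℝ (EuclideanSpace ℝ (Fin d)), Module.finrank ℝ M = s →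
        (∀ u ∈ M, inner ℝ u (gradient h a) = 0) →
        ∀ ξ : ℝ, 0 < ξ → ξ ≤ r →
          ∃ η : ℝ, 0 ≤ η ∧ η ≤ ξ ∧ ∀ u ∈ M, ‖u‖ = 1 → a + η • u ∈ U →
            B s * ξ ^ (α s) ≤ ‖M.starProjection (gradient h (a + η • u))‖

/-- The assumption on the unperturbed Hamiltonian function: `h` is smooth, homogeneous of degree
`m > 1` at infinity (it coincides, outside a ball, with a function `h₀` which is positively
homogeneous of degree `m` on `ℝ^d ∖ {0}`), and `h₀` is steep in an open subset `U`
of the annulus `B_1 ∖ B_{1/2}` that contains all the points of the cone `𝒞` in the annulus. -/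
structure AssumptionL {d : ℕ} (𝒞 : ProperCone ℝ (EuclideanSpace ℝ (Fin d))) (m : ℝ)
    (h : EuclideanSpace ℝ (Fin d) → ℝ) : Prop where
  one_lt_degree : 1 < m
  smooth : ContDiff ℝ ∞ h
  homogeneous_steep : ∃ h₀ : EuclideanSpace ℝ (Fin d) → ℝ,
    (∀ (t : ℝ) (a : EuclideanSpace ℝ (Fin d)), 0 < t → a ≠ 0 → h₀ (t • a) = t ^ m * h₀ a) ∧
    (∃ ρ : ℝ, 0 < ρ ∧ ∀ a, ρ ≤ ‖a‖ → h a = h₀ a) ∧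
    ∃ U : Set (EuclideanSpace ℝ (Fin d)), IsSteep h₀ U ∧
      U ⊆ {a | 1 / 2 < ‖a‖ ∧ ‖a‖ < 1} ∧
      (𝒞 : Set (EuclideanSpace ℝ (Fin d))) ∩ U
        = (𝒞 : Set (EuclideanSpace ℝ (Fin d))) ∩ {a | 1 / 2 < ‖a‖ ∧ ‖a‖ < 1}

/-- A module of `ℤ^d`: a subset `M` with `span_ℝ(M) ∩ ℤ^d = M`. -/
structure LatticeModule (d : ℕ) where
  carrier : Set (Fin d → ℤ)
  saturated : ∀ k : Fin d → ℤ, intVec k ∈ Submodule.span ℝ (intVec '' carrier) ↔ k ∈ carrier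

/-- The dimension of a module of `ℤ^d`, that is, of its real span. -/
noncomputable def LatticeModule.dim {d : ℕ} (M : LatticeModule d) : ℕ :=
  Module.finrank ℝ (Submodule.span ℝ (intVec '' M.carrier))

/-- `a` is resonant with `k ∈ ℤ^d` (with parameters `δ`, `μ`, `R`):
`|w(a)·k| < ‖a‖^δ ‖k‖`, `‖k‖ ≤ ‖a‖^μ` and `‖a‖ ≥ R`, where `w = ∇h`. -/
def IsResonant {d : ℕ} (h : EuclideanSpace ℝ (Fin d) → ℝ) (δ μ R : ℝ)
    (a : EuclideanSpace ℝ (Fin d)) (k : Fin d → ℤ) : Prop :=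
  |inner ℝ (gradient h a) (intVec k)| < ‖a‖ ^ δ * ‖intVec k‖ ∧ ‖intVec k‖ ≤ ‖a‖ ^ μ ∧ R ≤ ‖a‖

/-! The blocks are the classes of the equivalence relation generated on the joint spectrum by the
links between `a` and `a + k`, where one end is resonant with `k` or `-k` respectively. Invariance
under resonant translations is then automatic. A class whose points are all resonant is labelled by
the module that all its resonances generate; a class with a nonresonant point gets the zero module.
Since resonant vectors are nonzero, the dimension of the label tells the two cases apart. Two
properties need analysis.

Separation (`AssumptionL.isResonant_of_close`): if `a` and `a + k` are close in position and energy,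
a second-order Taylor expansion of `h` makes `∇h(a) · k` small compared with `‖a‖ ^ δ ‖k‖`, so the
points are linked and lie in the same class.

Dyadicity (`AssumptionL.norm_sub_le_of_reflTransGen`): a chain of links, however long, must not
wander far. This is the geometric part of Nekhoroshev theory. Homogeneity rescales the chain to size
one, where it becomes a walk with short steps almost orthogonal to the gradient `g`. By induction on
the dimension of the span `V` of the steps (`norm_sub_le_of_resonant_walk`), `g` is almost
orthogonal to `V` all along the walk. A walk that went far would cross a sphere on which steepness
keeps the projection of `g` on `V` away from zero. The powers lost at the successive dimensions are
absorbed by the scales of `exists_scales`. -/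

/-! ### Integer vectors, Gram determinants and projections. -/

theorem intVec_apply {d : ℕ} (k : Fin d → ℤ) (i : Fin d) : intVec k i = (k i : ℝ) := rfl

theorem intVec_neg {d : ℕ} (k : Fin d → ℤ) : intVec (-k) = -intVec k := by
  ext i; simp [intVec_apply]

theorem intVec_sub {d : ℕ} (k l : Fin d → ℤ) : intVec (k - l) = intVec k - intVec l := by
  ext i; simp [intVec_apply]

theorem intVec_zero {d : ℕ} : intVec (0 : Fin d → ℤ) = 0 := by
  ext i; simp [intVec_apply]

theorem inner_intVec_intVec {d : ℕ} (k l : Fin d → ℤ) :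
    inner ℝ (intVec k) (intVec l) = ((∑ i, k i * l i : ℤ) : ℝ) := by
  simp [PiLp.inner_apply, intVec_apply, mul_comm]

theorem one_le_norm_intVec {d : ℕ} {k : Fin d → ℤ} (hk : k ≠ 0) : 1 ≤ ‖intVec k‖ := by
  obtain ⟨i, hi⟩ := Function.ne_iff.mp hk
  have h1 : (1 : ℝ) ≤ |(k i : ℝ)| := by exact_mod_cast Int.one_le_abs hi
  have h2 := PiLp.norm_apply_le (intVec k) i
  rw [intVec_apply, Real.norm_eq_abs] at h2
  exact h1.trans h2

/-- The determinant is positive by independence, and it is an integer. -/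
theorem one_le_det_gram_intVec {d : ℕ} {n : Type*} [Fintype n] [DecidableEq n]
    (k : n → Fin d → ℤ) (hk : LinearIndependent ℝ (fun i => intVec (k i))) :
    1 ≤ (Matrix.gram ℝ (fun i => intVec (k i))).det := by
  have h0 := (Matrix.posDef_gram_of_linearIndependent hk).det_pos
  have h1 : Matrix.gram ℝ (fun i => intVec (k i)) =
      (Int.castRingHom ℝ).mapMatrix (Matrix.of fun i j => ∑ l, k i l * k j l) := by
    ext i j
    simp [Matrix.gram_apply, inner_intVec_intVec]
  rw [h1, ← RingHom.map_det] at h0 ⊢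
  simp only [eq_intCast] at h0 ⊢
  exact_mod_cast h0

theorem abs_adjugate_apply_le {n : Type*} [Fintype n] [DecidableEq n] (G : Matrix n n ℝ) {X : ℝ}
    (hX : 1 ≤ X) (hG : ∀ i j, |G i j| ≤ X) (i j : n) :
    |G.adjugate i j| ≤ (Fintype.card n).factorial * X ^ Fintype.card n := by
  rw [Matrix.adjugate_apply]
  have := Matrix.det_le (A := G.updateRow j (Pi.single i 1)) (abv := AbsoluteValue.abs) (x := X) ?_
  · simpa using this
  · intro a b
    simp only [AbsoluteValue.abs_apply, Matrix.updateRow_apply]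
    split_ifs with h
    · rw [Pi.single_apply]
      split_ifs <;> simp <;> linarith
    · exact hG a b

/-- The coefficients `c` of the projection solve `G c = (⟨z, v j⟩)` with `G` the Gram matrix. In
Cramer's rule the divisor `det G` is at least one, so only powers of `Q` are lost. -/
theorem norm_starProjection_le_of_linearIndependent {d : ℕ} {n : Type*} [Fintype n]
    (k : n → Fin d → ℤ) (hk : LinearIndependent ℝ (fun i => intVec (k i))) {Q ε : ℝ} (hQ : 1 ≤ Q)
    (hε : 0 ≤ ε) (hkQ : ∀ i, ‖intVec (k i)‖ ≤ Q) (z : EuclideanSpace ℝ (Fin d))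
    (hz : ∀ i, |inner ℝ z (intVec (k i))| ≤ ε * ‖intVec (k i)‖) :
    ‖(Submodule.span ℝ (Set.range fun i => intVec (k i))).starProjection z‖ ≤
      (d ^ 2 * d.factorial : ℕ) * Q ^ (2 * d + 2) * ε := by
  classical
  set v : n → EuclideanSpace ℝ (Fin d) := fun i => intVec (k i) with hv
  set V := Submodule.span ℝ (Set.range v) with hV
  set N := Fintype.card n with hN
  have hNd : N ≤ d := by simpa using hk.fintype_card_le_finrank
  obtain ⟨c, hc⟩ := (Submodule.mem_span_range_iff_exists_fun ℝ).mp
    (Submodule.starProjection_apply_mem V z)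
  set G := Matrix.gram ℝ v with hG
  have hdet : 1 ≤ G.det := one_le_det_gram_intVec k hk
  have hGc : G.mulVec c = fun j => inner ℝ z (v j) := by
    ext j
    have hj : inner ℝ (z - V.starProjection z) (v j) = 0 :=
      Submodule.starProjection_inner_eq_zero z (v j) (Submodule.subset_span ⟨j, rfl⟩)
    rw [inner_sub_left, sub_eq_zero] at hj
    rw [hj, ← hc, sum_inner]
    simp only [Matrix.mulVec, dotProduct, hG, Matrix.gram_apply, real_inner_smul_left]
    exact Finset.sum_congr rfl fun i _ => by rw [real_inner_comm]; ring
  have hcs : G.det • c = G.adjugate.mulVec fun j => inner ℝ z (v j) := by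
    rw [← hGc, Matrix.mulVec_mulVec, Matrix.adjugate_mul, Matrix.smul_mulVec, Matrix.one_mulVec]
  have hGX : ∀ i j, |G i j| ≤ Q ^ 2 := by
    intro i j
    rw [hG, Matrix.gram_apply]
    calc |inner ℝ (v i) (v j)| ≤ ‖v i‖ * ‖v j‖ := abs_real_inner_le_norm _ _
      _ ≤ Q * Q := mul_le_mul (hkQ i) (hkQ j) (norm_nonneg _) (by linarith)
      _ = Q ^ 2 := by ring
  have hQ2 : 1 ≤ Q ^ 2 := one_le_pow₀ hQ
  have hci : ∀ i, |c i| ≤ N * (N.factorial * (Q ^ 2) ^ N * (ε * Q)) := by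
    intro i
    have h1 : |c i| ≤ |G.det * c i| := by
      rw [abs_mul]
      exact le_mul_of_one_le_left (abs_nonneg _) (hdet.trans (le_abs_self _))
    have h2 : G.det * c i = ∑ j, G.adjugate i j * inner ℝ z (v j) := by
      simpa [Matrix.mulVec, dotProduct] using congrFun hcs i
    rw [h2] at h1
    refine h1.trans ((Finset.abs_sum_le_sum_abs _ _).trans ?_)
    calc ∑ j, |G.adjugate i j * inner ℝ z (v j)|
        ≤ ∑ _j : n, N.factorial * (Q ^ 2) ^ N * (ε * Q) := by
          refine Finset.sum_le_sum fun j _ => ?_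
          rw [abs_mul]
          refine mul_le_mul (abs_adjugate_apply_le G hQ2 hGX i j)
            ((hz j).trans (mul_le_mul_of_nonneg_left (hkQ j) hε)) (abs_nonneg _) (by positivity)
      _ = _ := by simp [hN]
  rw [← hc]
  calc ‖∑ i, c i • v i‖ ≤ ∑ i, ‖c i • v i‖ := norm_sum_le _ _
    _ ≤ ∑ _i : n, N * (N.factorial * (Q ^ 2) ^ N * (ε * Q)) * Q := by
        refine Finset.sum_le_sum fun i _ => ?_
        rw [norm_smul, Real.norm_eq_abs]
        exact mul_le_mul (hci i) (hkQ i) (norm_nonneg _) (by positivity)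
    _ = (N ^ 2 * N.factorial : ℕ) * Q ^ (2 * N + 2) * ε := by
        simp only [Finset.sum_const, Finset.card_univ, nsmul_eq_mul, ← hN]
        push_cast; ring
    _ ≤ _ := by gcongr

/-- Almost orthogonality of `z` to short integer vectors controls its projection on their span,
because the Gram determinant of independent integer vectors is at least one. -/
theorem norm_starProjection_span_intVec_le {d : ℕ} (s : Set (Fin d → ℤ)) {Q ε : ℝ} (hQ : 1 ≤ Q)
    (hε : 0 ≤ ε) (hs : ∀ k ∈ s, ‖intVec k‖ ≤ Q) (z : EuclideanSpace ℝ (Fin d))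
    (hz : ∀ k ∈ s, |inner ℝ z (intVec k)| ≤ ε * ‖intVec k‖) :
    ‖(Submodule.span ℝ (intVec '' s)).starProjection z‖ ≤
      (d ^ 2 * d.factorial : ℕ) * Q ^ (2 * d + 2) * ε := by
  obtain ⟨b, hbs, hspan, hli⟩ := exists_linearIndependent ℝ (intVec '' s)
  have : Finite b := hli.finite
  have : Fintype b := Fintype.ofFinite b
  choose k hks hk using fun x : b => hbs x.2
  have hk' : (fun i => intVec (k i)) = (Subtype.val : b → _) := funext hk
  have := norm_starProjection_le_of_linearIndependent k (hk' ▸ hli) hQ hε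
    (fun i => hs _ (hks i)) z (fun i => hz _ (hks i))
  have hV : Submodule.span ℝ (intVec '' s) =
      Submodule.span ℝ (Set.range fun i => intVec (k i)) := by
    rw [hk', Subtype.range_coe, hspan]
  simpa only [hV] using this

/-! ### From steepness to relaxed steepness. -/

/-- Steepness of the vector field `g` on `S`, relaxed to subspaces to which `g` is only almost
orthogonal and to points which only almost lie on the sphere of radius `η`. -/
def IsRelaxedSteep {d : ℕ} (g : EuclideanSpace ℝ (Fin d) → EuclideanSpace ℝ (Fin d))
    (S : Set (EuclideanSpace ℝ (Fin d))) (C β r : ℝ) : Prop :=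
  ∀ V : Submodule ℝ (EuclideanSpace ℝ (Fin d)), V ≠ ⊥ → ∀ x ∈ S, ∀ ε : ℝ,
    ‖V.starProjection (g x)‖ ≤ ε → ∀ ξ : ℝ, 0 < ξ → ξ ≤ r →
      ∃ η : ℝ, 0 ≤ η ∧ η ≤ ξ ∧ ∀ u ∈ V, ‖u‖ = 1 → ∀ y ∈ S, ‖y - (x + η • u)‖ ≤ ε →
        ‖V.starProjection (g y)‖ ≤ ε → ξ ^ β ≤ C * ε

theorem norm_sub_inv_norm_smul_le {E : Type*} [NormedAddCommGroup E] [NormedSpace ℝ E] {u t : E}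
    (hu : ‖u‖ = 1) (ht : t ≠ 0) : ‖‖t‖⁻¹ • t - u‖ ≤ 2 * ‖t - u‖ := by
  have h1 : ‖‖t‖⁻¹ • t - t‖ ≤ ‖t - u‖ := by
    have : ‖t‖⁻¹ • t - t = (‖t‖⁻¹ - 1) • t := by module
    rw [this, norm_smul, Real.norm_eq_abs]
    have h0 : 0 < ‖t‖ := norm_pos_iff.mpr ht
    rw [← abs_of_pos h0, ← abs_mul, abs_of_pos h0, sub_mul, inv_mul_cancel₀ h0.ne', one_mul, ← hu,
      norm_sub_rev]
    exact abs_norm_sub_norm_le u t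
  calc ‖‖t‖⁻¹ • t - u‖ ≤ ‖‖t‖⁻¹ • t - t‖ + ‖t - u‖ := norm_sub_le_norm_sub_add_norm_sub _ _ _
    _ ≤ _ := by linarith

section Tilt

variable {E : Type*} [NormedAddCommGroup E] [InnerProductSpace ℝ E] [FiniteDimensional ℝ E]

/-- For `u ∈ V` the component removed is governed by `⟨w, u⟩ = ⟨Π_V w, u⟩`, which is small. -/
theorem norm_sub_starProjection_orthogonal_singleton_le (V : Submodule ℝ E) {w u : E} {c ε : ℝ}
    (hc : 0 < c) (hw : c ≤ ‖w‖) (hV : ‖V.starProjection w‖ ≤ ε) (hu : u ∈ V) :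
    ‖(Submodule.span ℝ {w})ᗮ.starProjection u - u‖ ≤ ε / c * ‖u‖ := by
  have hw0 : 0 < ‖w‖ := hc.trans_le hw
  have h1 : (Submodule.span ℝ {w})ᗮ.starProjection u - u = -((inner ℝ w u / ‖w‖ ^ 2) • w) := by
    rw [Submodule.starProjection_orthogonal_val, Submodule.starProjection_singleton]
    simp
  have h2 : inner ℝ w u = inner ℝ (V.starProjection w) u := by
    rw [Submodule.inner_starProjection_left_eq_right, Submodule.starProjection_eq_self_iff.mpr hu]
  have h3 : |inner ℝ w u| ≤ ε * ‖u‖ := by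
    rw [h2]
    exact (abs_real_inner_le_norm _ _).trans (by gcongr)
  have hε : 0 ≤ ε := (norm_nonneg _).trans hV
  rw [h1, norm_neg, norm_smul, Real.norm_eq_abs, abs_div, abs_of_pos (by positivity : 0 < ‖w‖ ^ 2)]
  calc |inner ℝ w u| / ‖w‖ ^ 2 * ‖w‖ = |inner ℝ w u| / ‖w‖ := by field_simp
    _ ≤ ε * ‖u‖ / c := by gcongr
    _ = _ := by ring

/-- Write the projection as `p = T v` and expand `‖p‖² = ⟨z, p⟩ = ⟨Π_V z, v⟩ + ⟨z, T v - v⟩`;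
moreover `‖v‖ ≤ 2 ‖p‖`. -/
theorem norm_starProjection_map_le (V : Submodule ℝ E) (T : E →ₗ[ℝ] E) {q : ℝ} (hq0 : 0 ≤ q) (hq : q ≤ 1 / 2)
    (hT : ∀ u ∈ V, ‖T u - u‖ ≤ q * ‖u‖) (z : E) :
    ‖(V.map T).starProjection z‖ ≤ 2 * (‖V.starProjection z‖ + ‖z‖ * q) := by
  obtain ⟨v, hv, hp⟩ := Submodule.mem_map.mp (Submodule.starProjection_apply_mem (V.map T) z)
  set p := (V.map T).starProjection z with hpd
  rcases eq_or_ne v 0 with rfl | hv0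
  · rw [← hp, map_zero, norm_zero]
    positivity
  have hv0' : 0 < ‖v‖ := norm_pos_iff.mpr hv0
  have hpp : ‖p‖ ^ 2 = inner ℝ z p := by
    rw [← real_inner_self_eq_norm_sq, hpd, Submodule.inner_starProjection_left_eq_right,
      Submodule.starProjection_eq_self_iff.mpr (Submodule.starProjection_apply_mem _ _)]
  have h1 : inner ℝ z p = inner ℝ (V.starProjection z) v + inner ℝ z (T v - v) := by
    rw [Submodule.inner_starProjection_left_eq_right, Submodule.starProjection_eq_self_iff.mpr hv,
      ← hp, inner_sub_right]
    ring
  have h2 : ‖v‖ ≤ 2 * ‖p‖ := by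
    have h3 := hT v hv
    have h4 : ‖v‖ ≤ ‖T v‖ + ‖T v - v‖ := by
      rw [norm_sub_rev]; simpa [add_comm] using norm_add_le (T v) (v - T v)
    rw [← hp]
    nlinarith
  have h5 : ‖p‖ ^ 2 ≤ (‖V.starProjection z‖ + ‖z‖ * q) * ‖v‖ := by
    rw [hpp, h1, add_mul]
    refine add_le_add (real_inner_le_norm _ _) ((real_inner_le_norm _ _).trans ?_)
    rw [mul_assoc]
    exact mul_le_mul_of_nonneg_left (hT v hv) (norm_nonneg _)
  have hp0 : 0 < ‖p‖ := by linarith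
  have h6 : 0 ≤ ‖V.starProjection z‖ + ‖z‖ * q := by positivity
  nlinarith

end Tilt

theorem finrank_map_of_norm_sub_le {E : Type*} [NormedAddCommGroup E] [InnerProductSpace ℝ E]
    (V : Submodule ℝ E) (T : E →ₗ[ℝ] E) {q : ℝ} (hq : q ≤ 1 / 2)
    (hT : ∀ u ∈ V, ‖T u - u‖ ≤ q * ‖u‖) : Module.finrank ℝ (V.map T) = Module.finrank ℝ V := by
  have hinj : Function.Injective (T.domRestrict V) := by
    rw [injective_iff_map_eq_zero]
    intro u hu
    have h1 := hT u u.2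
    rw [LinearMap.domRestrict_apply] at hu
    rw [hu, zero_sub, norm_neg] at h1
    have : ‖(u : E)‖ = 0 := by nlinarith [norm_nonneg (u : E)]
    exact Subtype.ext (norm_eq_zero.mp this)
  rw [← LinearMap.finrank_range_of_inj hinj, LinearMap.range_domRestrict]

/-- Tilting `V` into the orthogonal complement of `g x` moves its unit vectors by `O(ε)`, so
steepness applies to the tilted space. Returning to `V` and to `y` costs `O(ε)` because `g` is
Lipschitz. -/
theorem isRelaxedSteep_of_steep {d : ℕ}
    {g : EuclideanSpace ℝ (Fin d) → EuclideanSpace ℝ (Fin d)}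
    {S U : Set (EuclideanSpace ℝ (Fin d))} {σ c G l r b β : ℝ} (hσ : 0 < σ)
    (hS : ∀ x ∈ S, ∀ y, ‖y - x‖ < σ → y ∈ U) (hc : 0 < c) (hcg : ∀ a ∈ U, c ≤ ‖g a‖)
    (hG : ∀ a ∈ U, ‖g a‖ ≤ G) (hG0 : 0 ≤ G) (hl : 0 ≤ l)
    (hlip : ∀ x ∈ U, ∀ y ∈ U, ‖g x - g y‖ ≤ l * ‖x - y‖) (hr : r ≤ 1) (hb : 0 < b) (hβ : 0 ≤ β)
    (hsteep : ∀ a ∈ U, ∀ s : ℕ, 1 ≤ s → s < d →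
      ∀ M : Submodule ℝ (EuclideanSpace ℝ (Fin d)), Module.finrank ℝ M = s →
        (∀ u ∈ M, inner ℝ u (g a) = 0) → ∀ ξ : ℝ, 0 < ξ → ξ ≤ r →
          ∃ η : ℝ, 0 ≤ η ∧ η ≤ ξ ∧ ∀ u ∈ M, ‖u‖ = 1 → a + η • u ∈ U →
            b * ξ ^ β ≤ ‖M.starProjection (g (a + η • u))‖) :
    ∃ C : ℝ, 0 < C ∧ IsRelaxedSteep g S C β r := by
  have hSU : ∀ x ∈ S, x ∈ U := fun x hx => hS x hx x (by simpa using hσ)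
  -- Below `ε₀` the tilt is injective on `V` and the displaced points stay in `U`. Above it the
  -- conclusion is trivial, as `ξ ≤ 1`.
  set ε₀ : ℝ := min (c / 2) (σ / (2 * (1 + 2 / c))) with hε₀
  have hε₀pos : 0 < ε₀ := by positivity
  set D : ℝ := 2 * (1 + l * (1 + 2 / c) + G / c) with hD
  have hDpos : 0 < D := by positivity
  refine ⟨ε₀⁻¹ + D / b, by positivity, ?_⟩
  intro V hV x hx ε hε ξ hξ hξr
  have hε0 : 0 ≤ ε := (norm_nonneg _).trans hε
  rcases le_or_gt ε₀ ε with hlarge | hsmall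
  · refine ⟨0, le_rfl, hξ.le, fun u _ _ y _ _ _ => ?_⟩
    calc ξ ^ β ≤ 1 := Real.rpow_le_one hξ.le (hξr.trans hr) hβ
      _ = ε₀⁻¹ * ε₀ := (inv_mul_cancel₀ hε₀pos.ne').symm
      _ ≤ (ε₀⁻¹ + D / b) * ε := by
        gcongr
        exact le_add_of_nonneg_right (by positivity)
  have hε1 : ε / c ≤ 1 / 2 := by
    rw [div_le_iff₀ hc]; linarith [min_le_left (c / 2) (σ / (2 * (1 + 2 / c)))]
  have hε2 : (1 + 2 / c) * ε < σ := by
    have h1 := hsmall.trans_le (min_le_right (c / 2) (σ / (2 * (1 + 2 / c))))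
    rw [lt_div_iff₀ (by positivity)] at h1
    have : 0 ≤ (1 + 2 / c) * ε := by positivity
    linarith
  -- Steepness concerns proper subspaces only; the whole space is excluded by `c ≤ ‖g x‖`.
  have hVtop : V ≠ ⊤ := by
    rintro rfl
    rw [Submodule.starProjection_top] at hε
    have := hcg x (hSU x hx)
    have h2 := min_le_left (c / 2) (σ / (2 * (1 + 2 / c)))
    simp only [ContinuousLinearMap.id_apply] at hε
    linarith
  set T : EuclideanSpace ℝ (Fin d) →ₗ[ℝ] EuclideanSpace ℝ (Fin d) :=
    (Submodule.span ℝ {g x})ᗮ.starProjection.toLinearMap with hT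
  have hTV : ∀ u ∈ V, ‖T u - u‖ ≤ ε / c * ‖u‖ := fun u hu =>
    norm_sub_starProjection_orthogonal_singleton_le V hc (hcg x (hSU x hx)) hε hu
  have hs1 : 1 ≤ Module.finrank ℝ V := Submodule.one_le_finrank_iff.mpr hV
  have hsd : Module.finrank ℝ V < d := by
    simpa using Submodule.finrank_lt hVtop
  have horth : ∀ u ∈ V.map T, inner ℝ u (g x) = 0 := by
    rintro _ ⟨u, -, rfl⟩
    have : T u ∈ (Submodule.span ℝ {g x})ᗮ := Submodule.starProjection_apply_mem _ _
    exact Submodule.inner_left_of_mem_orthogonal (Submodule.mem_span_singleton_self _) this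
  obtain ⟨η, hη0, hηξ, hη⟩ := hsteep x (hSU x hx) _ hs1 hsd (V.map T)
    (finrank_map_of_norm_sub_le V T hε1 hTV) horth ξ hξ hξr
  refine ⟨η, hη0, hηξ, fun u hu hu1 y hy hyx hyε => ?_⟩
  have hTu : ‖T u - u‖ ≤ ε / c := by simpa [hu1] using hTV u hu
  have hTu0 : T u ≠ 0 := by
    intro h0
    rw [h0, zero_sub, norm_neg, hu1] at hTu
    linarith
  set u' := ‖T u‖⁻¹ • T u with hu'
  have hu'V : u' ∈ V.map T := Submodule.smul_mem _ _ (Submodule.mem_map_of_mem hu)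
  have hu'1 : ‖u'‖ = 1 := norm_smul_inv_norm hTu0
  have huu' : ‖u' - u‖ ≤ 2 / c * ε :=
    (norm_sub_inv_norm_smul_le hu1 hTu0).trans (by rw [div_mul_eq_mul_div, mul_div_assoc]; gcongr)
  have hyy' : ‖x + η • u' - y‖ ≤ (1 + 2 / c) * ε := by
    have : x + η • u' - y = η • (u' - u) - (y - (x + η • u)) := by module
    rw [this]
    refine (norm_sub_le _ _).trans ?_
    rw [norm_smul, Real.norm_eq_abs, abs_of_nonneg hη0]
    have : η * ‖u' - u‖ ≤ 1 * (2 / c * ε) :=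
      mul_le_mul (by linarith) huu' (norm_nonneg _) zero_le_one
    linarith
  have hy'U : x + η • u' ∈ U := hS y hy _ (hyy'.trans_lt hε2)
  have h1 := hη u' hu'V hu'1 hy'U
  have h2 := norm_starProjection_map_le V T (by positivity) hε1 hTV (g (x + η • u'))
  have h3 : ‖V.starProjection (g (x + η • u'))‖ ≤ ε + l * ((1 + 2 / c) * ε) := by
    have : g (x + η • u') = g y + (g (x + η • u') - g y) := by abel
    rw [this, map_add]
    refine (norm_add_le _ _).trans (add_le_add hyε ?_)
    refine (Submodule.norm_starProjection_apply_le _ _).trans ?_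
    exact (hlip _ hy'U _ (hSU y hy)).trans (by gcongr)
  have h4 : ‖g (x + η • u')‖ * (ε / c) ≤ G * (ε / c) := by
    gcongr
    exact hG _ hy'U
  have h5 : b * ξ ^ β ≤ D * ε := by
    refine (h1.trans h2).trans ?_
    calc _ ≤ 2 * (ε + l * ((1 + 2 / c) * ε) + G * (ε / c)) := by linarith
      _ = D * ε := by rw [hD]; ring
  calc ξ ^ β ≤ D / b * ε := by
        rw [div_mul_eq_mul_div, le_div_iff₀ hb]; linarith
    _ ≤ _ := by
        gcongr
        exact le_add_of_nonneg_left (by positivity)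

/-! ### Confinement of walks by induction on the dimension. -/

/-- Span of the steps of a walk with indices in `[p, q)`. -/
noncomputable def stepSpan {d : ℕ} (k : ℕ → Fin d → ℤ) (p q : ℕ) :
    Submodule ℝ (EuclideanSpace ℝ (Fin d)) :=
  Submodule.span ℝ (intVec '' (k '' Set.Ico p q))

theorem stepSpan_mono {d : ℕ} (k : ℕ → Fin d → ℤ) {p q p' q' : ℕ} (hp : p ≤ p') (hq : q' ≤ q) :
    stepSpan k p' q' ≤ stepSpan k p q :=
  Submodule.span_mono (Set.image_mono (Set.image_mono (Set.Ico_subset_Ico hp hq)))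

theorem sub_mem_stepSpan {d : ℕ} {k : ℕ → Fin d → ℤ} {x : ℕ → EuclideanSpace ℝ (Fin d)} {θ : ℝ}
    {p q : ℕ} (hpq : p ≤ q) (hx : ∀ i, p ≤ i → i < q → x (i + 1) - x i = θ • intVec (k i)) :
    x q - x p ∈ stepSpan k p q := by
  induction q, hpq using Nat.le_induction with
  | base => simp
  | succ q hpq ih =>
    have h1 := stepSpan_mono k le_rfl q.le_succ (ih fun i hi hiq => hx i hi (by omega))
    have h2 : x (q + 1) - x q ∈ stepSpan k p (q + 1) := by
      rw [hx q hpq q.lt_succ_self]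
      exact Submodule.smul_mem _ _ (Submodule.subset_span ⟨k q, ⟨q, ⟨hpq, q.lt_succ_self⟩, rfl⟩, rfl⟩)
    simpa using Submodule.add_mem _ h2 h1

/-- A shortest interval around `i` with span of dimension `s`. -/
theorem exists_interval_finrank_stepSpan {d : ℕ} (k : ℕ → Fin d → ℤ) {p q i s : ℕ} (hpi : p ≤ i)
    (hiq : i ≤ q) (hs : s + 1 ≤ Module.finrank ℝ (stepSpan k p q)) :
    ∃ p' q', p ≤ p' ∧ p' ≤ i ∧ i ≤ q' ∧ q' ≤ q ∧
      s + 1 ≤ Module.finrank ℝ (stepSpan k p' q') ∧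
      (i < q' → Module.finrank ℝ (stepSpan k p' (q' - 1)) ≤ s) ∧
      (p' < i → Module.finrank ℝ (stepSpan k (p' + 1) q') ≤ s) := by
  by_contra! hcon
  have key : ∀ n p' q', q' - p' ≤ n → p ≤ p' → p' ≤ i → i ≤ q' → q' ≤ q →
      ¬ s + 1 ≤ Module.finrank ℝ (stepSpan k p' q') := by
    intro n
    induction n with
    | zero =>
      intro p' q' hn _ _ _ _ h
      have : stepSpan k p' q' = ⊥ := by
        rw [stepSpan, Set.Ico_eq_empty (by omega)]; simp
      rw [this] at h
      simp at h
    | succ n ih =>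
      intro p' q' hn h1 h2 h3 h4 h
      by_cases h5 : i < q' → Module.finrank ℝ (stepSpan k p' (q' - 1)) ≤ s
      · obtain ⟨h6, h7⟩ := hcon p' q' h1 h2 h3 h4 h h5
        exact ih (p' + 1) q' (by omega) (by omega) (by omega) h3 h4 h7
      · push Not at h5
        exact ih p' (q' - 1) (by omega) h1 h2 (by omega) (by omega) h5.2
  exact key (q - p) p q le_rfl le_rfl hpi hiq le_rfl hs

theorem exists_first_exit {E : Type*} [SeminormedAddCommGroup E] (x : ℕ → E) {p q : ℕ} {η : ℝ}
    (hη : 0 ≤ η) (hpq : p ≤ q) (h : η < ‖x q - x p‖) :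
    ∃ i, p ≤ i ∧ i < q ∧ ‖x i - x p‖ ≤ η ∧ η < ‖x (i + 1) - x p‖ := by
  induction q, hpq using Nat.le_induction with
  | base => simp at h; linarith
  | succ q hpq ih =>
    by_cases h1 : η < ‖x q - x p‖
    · obtain ⟨i, h2, h3, h4⟩ := ih h1
      exact ⟨i, h2, by omega, h4⟩
    · exact ⟨q, hpq, by omega, not_lt.mp h1, h⟩

/-- Confinement of resonant walks: along a walk in `S` with short integer steps, each of which
is almost orthogonal to `g`, the displacement is controlled by the dimension of the span of
the steps. -/
theorem norm_sub_le_of_resonant_walk {d : ℕ}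
    {g : EuclideanSpace ℝ (Fin d) → EuclideanSpace ℝ (Fin d)} {S : Set (EuclideanSpace ℝ (Fin d))}
    {C β r l Q ρ θ : ℝ} (hg : IsRelaxedSteep g S C β r) (hl : 0 ≤ l)
    (hlip : ∀ x ∈ S, ∀ y ∈ S, ‖g x - g y‖ ≤ l * ‖x - y‖) (hQ : 1 ≤ Q) (hd : 1 ≤ d)
    {x : ℕ → EuclideanSpace ℝ (Fin d)} {k : ℕ → Fin d → ℤ} {N : ℕ}
    (hxS : ∀ i ≤ N, x i ∈ S) (hx : ∀ i < N, x (i + 1) - x i = θ • intVec (k i))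
    (hkQ : ∀ i < N, ‖intVec (k i)‖ ≤ Q)
    (hres : ∀ i < N, |inner ℝ (g (x i)) (intVec (k i))| ≤ ρ * ‖intVec (k i)‖)
    {ξ : ℕ → ℝ} (hξ0 : 0 < ξ 0) (hξmono : Monotone ξ) (hξr : ξ d ≤ r)
    (hρ : ρ ≤ ξ 0) (hstep : ∀ i < N, ‖x (i + 1) - x i‖ ≤ ξ 0)
    (hξ : ∀ s < d, C * ((d ^ 2 * d.factorial : ℕ) * Q ^ (2 * d + 2) * ((1 + 2 * l) * ξ s)) <
      ξ (s + 1) ^ β) :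
    ∀ s ≤ d, ∀ p q, p ≤ q → q ≤ N → Module.finrank ℝ (stepSpan k p q) ≤ s →
      ‖x q - x p‖ ≤ ξ s := by
  have hξpos : ∀ s, 0 < ξ s := fun s => hξ0.trans_le (hξmono s.zero_le)
  intro s
  induction s with
  | zero =>
    intro _ p q hpq hqN h0
    have h1 : stepSpan k p q = ⊥ := Submodule.finrank_eq_zero.mp (by omega)
    have h2 := sub_mem_stepSpan hpq fun i _ hi => hx i (by omega)
    rw [h1, Submodule.mem_bot] at h2
    rw [h2, norm_zero]
    exact hξ0.le
  | succ s ih =>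
    intro hsd p q hpq hqN hsV
    replace ih := ih (by omega)
    by_cases hs : Module.finrank ℝ (stepSpan k p q) ≤ s
    · exact (ih p q hpq hqN hs).trans (hξmono s.le_succ)
    set V := stepSpan k p q with hV
    have hVs : Module.finrank ℝ V = s + 1 := by omega
    set D : ℝ := (d ^ 2 * d.factorial : ℕ) * Q ^ (2 * d + 2) with hD
    have hD1 : 1 ≤ D := by
      have h1 : (1 : ℝ) ≤ (d ^ 2 * d.factorial : ℕ) := by
        exact_mod_cast Nat.mul_pos (by positivity) (Nat.factorial_pos d)
      have h2 : 1 ≤ Q ^ (2 * d + 2) := one_le_pow₀ hQ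
      nlinarith
    set ε := D * ((1 + 2 * l) * ξ s) with hε
    have hξs := hξpos s
    have hξε : ξ s ≤ ε := by
      have h1 : ξ s ≤ (1 + 2 * l) * ξ s := by nlinarith
      have h2 : (1 + 2 * l) * ξ s ≤ ε := le_mul_of_one_le_left (by positivity) hD1
      linarith
    -- Take a shortest interval around `i` whose steps still span `V`. Shortening it lowers the
    -- dimension, so by induction `x i` is close to every `x j` in it, and `g (x i)` inherits the
    -- almost orthogonality of `g (x j)` to `k j`.
    have hproj : ∀ i, p ≤ i → i ≤ q → ‖V.starProjection (g (x i))‖ ≤ ε := by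
      intro i hpi hiq
      obtain ⟨p', q', hpp', hp'i, hiq', hq'q, hfin, hright, hleft⟩ :=
        exists_interval_finrank_stepSpan k hpi hiq hVs.ge
      have hVeq : stepSpan k p' q' = V :=
        Submodule.eq_of_le_of_finrank_le (stepSpan_mono k hpp' hq'q) (by omega)
      have hclose : ∀ j, p' ≤ j → j < q' → ‖x i - x j‖ ≤ 2 * ξ s := by
        intro j hp'j hjq'
        have hsub : ∀ p'' q'', p' ≤ p'' → p'' ≤ q'' → q'' ≤ q' →
            Module.finrank ℝ (stepSpan k p'' q'') ≤ s → ‖x q'' - x p''‖ ≤ ξ s :=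
          fun p'' q'' h1 h2 h3 h4 => ih p'' q'' h2 (by omega) h4
        rcases lt_or_ge i q' with hi | hi
        · have hsmall : ∀ p'' q'', p' ≤ p'' → q'' ≤ q' - 1 →
              Module.finrank ℝ (stepSpan k p'' q'') ≤ s := fun p'' q'' h1 h2 =>
            (Submodule.finrank_mono (stepSpan_mono k h1 h2)).trans (hright hi)
          rcases le_total i j with hij | hij
          · have := hsub i j hp'i hij hjq'.le (hsmall i j hp'i (by omega))
            rw [norm_sub_rev]; linarith
          · have := hsub j i hp'j hij hiq' (hsmall j i hp'j (by omega))
            linarith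
        -- Here only the left end can be shortened: dropping index `p'` leaves the walk from `j +
        -- 1`, and the step from `j` is added by hand.
        · have hiq'' : i = q' := le_antisymm hiq' hi
          have hp'lt : p' < i := by omega
          have hsmall : ∀ p'', p' + 1 ≤ p'' → Module.finrank ℝ (stepSpan k p'' q') ≤ s :=
            fun p'' h1 => (Submodule.finrank_mono (stepSpan_mono k h1 le_rfl)).trans (hleft hp'lt)
          have h1 := hsub (j + 1) q' (by omega) (by omega) le_rfl (hsmall (j + 1) (by omega))
          have h2 := (hstep j (by omega)).trans (hξmono s.zero_le)
          have h3 := norm_sub_le_norm_sub_add_norm_sub (x i) (x (j + 1)) (x j)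
          rw [← hiq''] at h1
          linarith
      rw [← hVeq]
      refine norm_starProjection_span_intVec_le _ hQ (by positivity) ?_ _ ?_
      · rintro _ ⟨j, hj, rfl⟩
        exact hkQ j (hj.2.trans_le (hq'q.trans hqN))
      · rintro _ ⟨j, hj, rfl⟩
        have hjN : j < N := hj.2.trans_le (hq'q.trans hqN)
        have h1 : inner ℝ (g (x i)) (intVec (k j)) = inner ℝ (g (x j)) (intVec (k j)) +
            inner ℝ (g (x i) - g (x j)) (intVec (k j)) := by rw [inner_sub_left]; ring
        rw [h1]
        refine (abs_add_le _ _).trans ?_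
        have h2 := hres j hjN
        have h3 : |inner ℝ (g (x i) - g (x j)) (intVec (k j))| ≤
            l * (2 * ξ s) * ‖intVec (k j)‖ := by
          refine (abs_real_inner_le_norm _ _).trans ?_
          gcongr
          exact (hlip _ (hxS i (by omega)) _ (hxS j (by omega))).trans
            (mul_le_mul_of_nonneg_left (hclose j hj.1 hj.2) hl)
        have h4 : ρ * ‖intVec (k j)‖ ≤ ξ s * ‖intVec (k j)‖ := by
          gcongr
          exact hρ.trans (hξmono s.zero_le)
        nlinarith
    -- The first point outside the ball of radius `η` is within one step, hence within `ε`, of the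
    -- sphere, in a direction of `V`. Relaxed steepness there contradicts the gap between `ξ s` and
    -- `ξ (s + 1)`.
    by_contra! hfar
    obtain ⟨η, hη0, hηξ, hη⟩ := hg V (by rw [ne_eq, ← Submodule.finrank_eq_zero]; omega) (x p)
      (hxS p (by omega)) ε (hproj p le_rfl hpq) (ξ (s + 1)) (hξpos _) ((hξmono hsd).trans hξr)
    obtain ⟨i, hpi, hiq, hin, hout⟩ := exists_first_exit x hη0 hpq (hηξ.trans_lt hfar)
    set t := x (i + 1) - x p with ht
    have htpos : 0 < ‖t‖ := hη0.trans_lt hout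
    have htV : t ∈ V := stepSpan_mono k le_rfl (by omega : i + 1 ≤ q)
      (sub_mem_stepSpan (by omega) fun j _ hj => hx j (by omega))
    have hlast := hη (‖t‖⁻¹ • t) (Submodule.smul_mem _ _ htV)
      (norm_smul_inv_norm (norm_pos_iff.mp htpos)) (x (i + 1)) (hxS _ (by omega)) ?_
      (hproj (i + 1) (by omega) (by omega))
    · exact absurd hlast (not_le.mpr (hξ s (by omega)))
    · have h1 : x (i + 1) - (x p + η • ‖t‖⁻¹ • t) = (1 - η * ‖t‖⁻¹) • t := by
        rw [sub_smul, one_smul, smul_smul, ht]; abel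
      have h2 : 0 ≤ 1 - η * ‖t‖⁻¹ := by
        rw [sub_nonneg, ← div_eq_mul_inv, div_le_one htpos]; exact hout.le
      rw [h1, norm_smul, Real.norm_eq_abs, abs_of_nonneg h2, sub_mul, mul_assoc,
        inv_mul_cancel₀ htpos.ne']
      have h3 := hstep i (by omega)
      have h4 := norm_sub_le_norm_sub_add_norm_sub (x (i + 1)) (x i) (x p)
      have h5 := hξmono s.zero_le
      linarith

/-! ### Rescaling to unit size. -/

theorem gradient_const_mul_comp_smul {E : Type*} [NormedAddCommGroup E] [InnerProductSpace ℝ E]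
    [CompleteSpace E] {f : E → ℝ} {c t : ℝ} {x : E} (hf : DifferentiableAt ℝ f (t • x)) :
    gradient (fun y => c * f (t • y)) x = (c * t) • gradient f (t • x) := by
  refine HasGradientAt.gradient ?_
  rw [hasGradientAt_iff_hasFDerivAt]
  have h1 : HasFDerivAt (fun y : E => t • y) (t • ContinuousLinearMap.id ℝ E) x :=
    (hasFDerivAt_id x).const_smul t
  have h2 := (hf.hasFDerivAt.comp x h1).const_mul c
  have h3 : InnerProductSpace.toDual ℝ E ((c * t) • gradient f (t • x)) =
      c • (fderiv ℝ f (t • x)).comp (t • ContinuousLinearMap.id ℝ E) := by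
    rw [map_smulₛₗ, toDual_gradient]
    ext y
    simp [mul_assoc]
  rw [h3]
  exact h2

theorem exists_lipschitz_gradient {E : Type*} [NormedAddCommGroup E] [InnerProductSpace ℝ E]
    [FiniteDimensional ℝ E] {f : E → ℝ} (hf : ContDiff ℝ ∞ f) (ρ : ℝ) :
    ∃ l : ℝ, 0 ≤ l ∧ ∀ x y, ‖x‖ ≤ ρ → ‖y‖ ≤ ρ →
      ‖gradient f x - gradient f y‖ ≤ l * ‖x - y‖ := by
  have h1 : ContDiff ℝ 1 (fderiv ℝ f) := hf.fderiv_right (by norm_cast)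
  obtain ⟨l, hl⟩ := (h1.locallyLipschitz.locallyLipschitzOn
    (s := Metric.closedBall (0 : E) ρ)).exists_lipschitzOnWith_of_compact (isCompact_closedBall 0 ρ)
  refine ⟨l, l.2, fun x y hx hy => ?_⟩
  rw [← dist_eq_norm, ← dist_eq_norm, ← (InnerProductSpace.toDual ℝ E).dist_map, toDual_gradient,
    toDual_gradient]
  exact hl.dist_le_mul x (by simpa) y (by simpa)

/-- For `ξ ≤ 1` raising the exponent weakens the bound, so `β` may dominate all `α s` while `b` lies
below all `B s`. -/
theorem exists_uniform_steepness_index {r : ℝ} {α B : ℕ → ℝ} {d : ℕ}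
    (hB : ∀ s, 1 ≤ s → s < d → 0 < B s) :
    ∃ b β : ℝ, 0 < b ∧ 1 ≤ β ∧ ∀ s, 1 ≤ s → s < d → ∀ ξ : ℝ, 0 < ξ → ξ ≤ min r 1 →
      b * ξ ^ β ≤ B s * ξ ^ α s := by
  have hnn : ∀ s ∈ Finset.Ico 1 d, 0 ≤ (B s)⁻¹ := fun s hs =>
    (inv_pos.mpr (hB s (Finset.mem_Ico.mp hs).1 (Finset.mem_Ico.mp hs).2)).le
  have hsum := Finset.sum_nonneg hnn
  have hsum2 : 0 ≤ ∑ s ∈ Finset.Ico 1 d, |α s| := Finset.sum_nonneg fun _ _ => abs_nonneg _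
  refine ⟨(1 + ∑ s ∈ Finset.Ico 1 d, (B s)⁻¹)⁻¹, 1 + ∑ s ∈ Finset.Ico 1 d, |α s|,
    by positivity, by linarith, fun s hs hsd ξ hξ hξ1 => ?_⟩
  have hmem : s ∈ Finset.Ico 1 d := Finset.mem_Ico.mpr ⟨hs, hsd⟩
  have h1 : (1 + ∑ s ∈ Finset.Ico 1 d, (B s)⁻¹)⁻¹ ≤ B s := by
    rw [inv_le_comm₀ (by positivity) (hB s hs hsd)]
    linarith [Finset.single_le_sum hnn hmem]
  have h2 : α s ≤ 1 + ∑ s ∈ Finset.Ico 1 d, |α s| := by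
    have := Finset.single_le_sum (fun i _ => abs_nonneg (α i)) hmem
    linarith [le_abs_self (α s)]
  have h3 : ξ ^ (1 + ∑ s ∈ Finset.Ico 1 d, |α s|) ≤ ξ ^ α s :=
    Real.rpow_le_rpow_of_exponent_ge hξ (hξ1.trans (min_le_right _ _)) h2
  have h4 := (hB s hs hsd).le
  gcongr

theorem AssumptionL.one_le_dim {d : ℕ} {𝒞 : ProperCone ℝ (EuclideanSpace ℝ (Fin d))} {m : ℝ}
    {h : EuclideanSpace ℝ (Fin d) → ℝ} (hL : AssumptionL 𝒞 m h) : 1 ≤ d := by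
  obtain ⟨-, -, -, U, ⟨-, hU, -⟩, hUsub, -⟩ := hL.homogeneous_steep
  obtain ⟨x, hx⟩ := hU.nonempty
  by_contra! hd
  obtain rfl : d = 0 := by omega
  have h1 := (hUsub hx).1
  rw [Subsingleton.elim x 0, norm_zero] at h1
  linarith

/-- The part of the cone in a compact annulus inside the annulus of the steepness assumption. -/
def coneAnnulus {d : ℕ} (𝒞 : ProperCone ℝ (EuclideanSpace ℝ (Fin d))) :
    Set (EuclideanSpace ℝ (Fin d)) :=
  {x | x ∈ 𝒞 ∧ 5 / 8 ≤ ‖x‖ ∧ ‖x‖ ≤ 7 / 8}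

theorem isCompact_coneAnnulus {d : ℕ} (𝒞 : ProperCone ℝ (EuclideanSpace ℝ (Fin d))) :
    IsCompact (coneAnnulus 𝒞) := by
  refine (isCompact_closedBall (0 : EuclideanSpace ℝ (Fin d)) (7 / 8)).of_isClosed_subset ?_
    fun x hx => by simpa using hx.2.2
  exact 𝒞.isClosed.inter ((isClosed_le continuous_const continuous_norm).inter
    (isClosed_le continuous_norm continuous_const))

theorem AssumptionL.exists_rescaled_gradient {d : ℕ}
    {𝒞 : ProperCone ℝ (EuclideanSpace ℝ (Fin d))} {m : ℝ}
    {h : EuclideanSpace ℝ (Fin d) → ℝ} (hL : AssumptionL 𝒞 m h) :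
    ∃ (g : EuclideanSpace ℝ (Fin d) → EuclideanSpace ℝ (Fin d)) (l t C β r : ℝ),
      0 ≤ l ∧ 1 ≤ t ∧ 0 < C ∧ 1 ≤ β ∧ 0 < r ∧
      (∀ x y, ‖x‖ ≤ 2 → ‖y‖ ≤ 2 → ‖g x - g y‖ ≤ l * ‖x - y‖) ∧
      (∀ c, t ≤ c → ∀ x, 1 / 4 < ‖x‖ → gradient h (c • x) = c ^ (m - 1) • g x) ∧
      IsRelaxedSteep g (coneAnnulus 𝒞) C β r := by
  obtain ⟨h₀, hhom, ⟨ρ, hρ, heq⟩, U, ⟨hUo, -, -, -, ⟨c, hc, hcU⟩, r, α, B, hr, hB, hsteep⟩,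
    hUsub, hCU⟩ := hL.homogeneous_steep
  -- The factor 4 puts `s • y` beyond radius `ρ` whenever `t ≤ s` and `1 / 4 < ‖y‖`.
  set t : ℝ := max 1 (4 * ρ) with ht
  have ht1 : 1 ≤ t := le_max_left _ _
  have ht0 : 0 < t := by linarith
  have htρ : 4 * ρ ≤ t := le_max_right _ _
  have hdiff : Differentiable ℝ h := hL.smooth.differentiable (by simp)
  -- This agrees with `∇h₀` for `1 / 4 < ‖x‖`, but it is smooth at the origin too, hence Lipschitz
  -- on a whole ball.
  set g : EuclideanSpace ℝ (Fin d) → EuclideanSpace ℝ (Fin d) :=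
    fun x => t ^ (1 - m) • gradient h (t • x) with hg
  have hopen : IsOpen {y : EuclideanSpace ℝ (Fin d) | 1 / 4 < ‖y‖} :=
    isOpen_lt continuous_const continuous_norm
  have hlarge : ∀ s, t ≤ s → ∀ y : EuclideanSpace ℝ (Fin d), 1 / 4 < ‖y‖ →
      h (s • y) = s ^ m * h₀ y := by
    intro s hs y hy
    have hs0 : 0 < s := ht0.trans_le hs
    rw [heq, hhom s y hs0 (norm_pos_iff.mp (by linarith))]
    rw [norm_smul, Real.norm_eq_abs, abs_of_pos hs0]
    nlinarith
  have hpow : t ^ (-m) * t = t ^ (1 - m) := by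
    rw [← Real.rpow_add_one ht0.ne', neg_add_eq_sub]
  have hgrad₀ : ∀ x, 1 / 4 < ‖x‖ → gradient h₀ x = g x := by
    intro x hx
    have h1 : h₀ =ᶠ[nhds x] fun y => t ^ (-m) * h (t • y) := by
      filter_upwards [hopen.mem_nhds hx] with y hy
      rw [hlarge t le_rfl y hy, ← mul_assoc, ← Real.rpow_add ht0, neg_add_cancel, Real.rpow_zero,
        one_mul]
    rw [h1.gradient_eq, gradient_const_mul_comp_smul (hdiff _), hpow]
  have hgrad : ∀ s, t ≤ s → ∀ x, 1 / 4 < ‖x‖ → gradient h (s • x) = s ^ (m - 1) • g x := by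
    intro s hs x hx
    have hs0 : 0 < s := ht0.trans_le hs
    have h1 : h₀ =ᶠ[nhds x] fun y => s ^ (-m) * h (s • y) := by
      filter_upwards [hopen.mem_nhds hx] with y hy
      rw [hlarge s hs y hy, ← mul_assoc, ← Real.rpow_add hs0, neg_add_cancel, Real.rpow_zero,
        one_mul]
    rw [← hgrad₀ x hx, h1.gradient_eq, gradient_const_mul_comp_smul (hdiff _), smul_smul,
      ← Real.rpow_add_one hs0.ne', ← Real.rpow_add hs0]
    ring_nf
    simp
  obtain ⟨l₀, hl₀, hlip₀⟩ := exists_lipschitz_gradient hL.smooth (2 * t)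
  have htm : 0 < t ^ (1 - m) := Real.rpow_pos_of_pos ht0 _
  have hlip : ∀ x y, ‖x‖ ≤ 2 → ‖y‖ ≤ 2 → ‖g x - g y‖ ≤ t ^ (1 - m) * l₀ * t * ‖x - y‖ := by
    intro x y hx hy
    have h1 : ∀ z : EuclideanSpace ℝ (Fin d), ‖t • z‖ = t * ‖z‖ := fun z => by
      rw [norm_smul, Real.norm_eq_abs, abs_of_pos ht0]
    have h2 := hlip₀ (t • x) (t • y) (by rw [h1]; nlinarith) (by rw [h1]; nlinarith)
    rw [← smul_sub, h1] at h2
    rw [hg]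
    simp only
    rw [← smul_sub, norm_smul, Real.norm_eq_abs, abs_of_pos htm]
    calc _ ≤ t ^ (1 - m) * (l₀ * (t * ‖x - y‖)) := by gcongr
      _ = _ := by ring
  have hU2 : ∀ a ∈ U, ‖a‖ ≤ 2 := fun a ha => by linarith [(hUsub ha).2]
  have hgU : ∀ a ∈ U, gradient h₀ a = g a := fun a ha => hgrad₀ a (by linarith [(hUsub ha).1])
  set l := t ^ (1 - m) * l₀ * t with hl
  have hl0 : 0 ≤ l := by positivity
  have hsub : coneAnnulus 𝒞 ⊆ U := by
    rintro x ⟨hx, hx1, hx2⟩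
    have : x ∈ (𝒞 : Set (EuclideanSpace ℝ (Fin d))) ∩ {a | 1 / 2 < ‖a‖ ∧ ‖a‖ < 1} :=
      ⟨hx, by linarith, by linarith⟩
    rw [← hCU] at this
    exact this.2
  obtain ⟨σ, hσ, hthick⟩ := (isCompact_coneAnnulus 𝒞).exists_thickening_subset_open hUo hsub
  obtain ⟨b, β, hb, hβ, hindex⟩ := exists_uniform_steepness_index (r := r) (α := α) hB
  obtain ⟨C, hC, hrelax⟩ := isRelaxedSteep_of_steep (g := g) (S := coneAnnulus 𝒞) (U := U)
    (G := ‖g 0‖ + l * 2) (r := min r 1) (β := β) hσ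
    (fun x hx y hy => hthick (Metric.mem_thickening_iff.mpr ⟨x, hx, by rwa [dist_eq_norm]⟩))
    hc (fun a ha => hgU a ha ▸ hcU a ha)
    (fun a ha => by
      have h1 := hlip a 0 (hU2 a ha) (by simp)
      have h2 := norm_le_norm_add_norm_sub' (g a) (g 0)
      rw [sub_zero] at h1
      nlinarith [hU2 a ha])
    (by positivity) hl0 (fun x hx y hy => hlip x y (hU2 x hx) (hU2 y hy)) (min_le_right _ _) hb
    (by linarith)
    (fun a ha s hs hsd M hM hort ξ hξ hξr => by
      obtain ⟨η, hη0, hηξ, hη⟩ := hsteep a ha s hs hsd M hM (by rwa [hgU a ha]) ξ hξ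
        (hξr.trans (min_le_left _ _))
      refine ⟨η, hη0, hηξ, fun u hu hu1 hmem => (hindex s hs hsd ξ hξ hξr).trans ?_⟩
      rw [← hgU _ hmem]
      exact hη u hu hu1 hmem)
  exact ⟨g, l, t, C, β, min r 1, hl0, ht1, hC, hβ, by positivity, hlip, hgrad, hrelax⟩

/-! ### The hierarchy of scales. -/

theorem eventually_const_mul_rpow_neg_lt {τ : ℝ} (hτ : 0 < τ) (A : ℝ) {b : ℝ} (hb : 0 < b) :
    ∀ᶠ t : ℝ in Filter.atTop, A * t ^ (-τ) < b := by
  have := (tendsto_rpow_neg_atTop hτ).const_mul A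
  rw [mul_zero] at this
  exact this.eventually_lt_const hb

/-- A hierarchy of `d + 1` scales, each a small power of `t`, for the confinement of walks. -/
theorem exists_scales {τ β r : ℝ} (n d : ℕ) (hτ : 0 < τ) (hβ : 1 ≤ β) (hr : 0 < r) (C A : ℝ) :
    ∃ μ₀ : ℝ, 0 < μ₀ ∧ μ₀ ≤ 1 / 2 ∧ ∀ μ : ℝ, 0 < μ → μ < μ₀ → ∀ᶠ t : ℝ in Filter.atTop,
      ∃ ξ : ℕ → ℝ, 0 < ξ 0 ∧ Monotone ξ ∧ ξ d ≤ r ∧ A * (t ^ (-τ) + t ^ (μ - 1)) ≤ ξ 0 ∧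
        ∀ s < d, C * (t ^ μ) ^ n * ξ s < ξ (s + 1) ^ β := by
  set τ₀ := min τ (1 / 2) / 2 with hτ₀
  have hτ₀pos : 0 < τ₀ := by positivity
  have hτ₀τ : 2 * τ₀ ≤ τ := by linarith [min_le_left τ (1 / 2)]
  have hτ₀h : 2 * τ₀ ≤ 1 / 2 := by linarith [min_le_right τ (1 / 2)]
  -- The scales are `ξ s = t ^ (-T s)`. Since `T (s + 1) * β = T s / 2`, the gap `t ^ (T s / 2)`
  -- beats the constant and `t ^ (μ n)` once `μ n ≤ T d / 4`.
  set T : ℕ → ℝ := fun s => τ₀ / (2 * β) ^ s with hT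
  have hTpos : ∀ s, 0 < T s := fun s => by positivity
  have hTanti : Antitone T := by
    intro s s' hs
    simp only [hT]
    gcongr
    linarith
  have hTsucc : ∀ s, T (s + 1) * β = T s / 2 := by
    intro s
    simp only [hT, pow_succ]
    field_simp
  refine ⟨min (1 / 2) (T d / (4 * (n + 1))), lt_min (by norm_num) (div_pos (hTpos d) (by positivity)),
    min_le_left _ _, ?_⟩
  intro μ hμ hμ₀
  have hμh : μ < 1 / 2 := hμ₀.trans_le (min_le_left _ _)
  have hμT : μ * n ≤ T d / 4 := by
    have h1 := hμ₀.trans_le (min_le_right _ _)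
    rw [lt_div_iff₀ (by positivity)] at h1
    nlinarith
  filter_upwards [eventually_const_mul_rpow_neg_lt (τ := T d / 4) (by linarith [hTpos d]) C one_pos,
    eventually_const_mul_rpow_neg_lt hτ₀pos (2 * |A|) one_pos,
    eventually_const_mul_rpow_neg_lt (hTpos d) 1 hr, Filter.eventually_ge_atTop 1]
    with t h1 h2 h3 ht
  have ht0 : 0 < t := by linarith
  refine ⟨fun s => t ^ (-T s), Real.rpow_pos_of_pos ht0 _, ?_, by simpa using h3.le, ?_, ?_⟩
  · intro s s' hs
    exact Real.rpow_le_rpow_of_exponent_le ht (neg_le_neg (hTanti hs))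
  · have h4 : t ^ (-τ) ≤ t ^ (-(2 * τ₀)) := Real.rpow_le_rpow_of_exponent_le ht (by linarith)
    have h5 : t ^ (μ - 1) ≤ t ^ (-(2 * τ₀)) := Real.rpow_le_rpow_of_exponent_le ht (by linarith)
    have h6 : t ^ (-(2 * τ₀)) = t ^ (-τ₀) * t ^ (-τ₀) := by
      rw [← Real.rpow_add ht0]; ring_nf
    have h7 : T 0 = τ₀ := by simp [hT]
    have h8 : 0 < t ^ (-τ₀) := Real.rpow_pos_of_pos ht0 _
    have h9 : 0 ≤ t ^ (-τ) + t ^ (μ - 1) := by positivity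
    simp only [h7]
    calc A * (t ^ (-τ) + t ^ (μ - 1)) ≤ |A| * (t ^ (-τ) + t ^ (μ - 1)) := by
          gcongr; exact le_abs_self A
      _ ≤ |A| * (2 * (t ^ (-τ₀) * t ^ (-τ₀))) := by
          gcongr; linarith
      _ = 2 * |A| * t ^ (-τ₀) * t ^ (-τ₀) := by ring
      _ ≤ 1 * t ^ (-τ₀) := by gcongr
      _ = _ := one_mul _
  · intro s hs
    have h4 : (t ^ (-T (s + 1))) ^ β = t ^ (-(T s / 2)) := by
      rw [← Real.rpow_mul ht0.le, neg_mul, hTsucc]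
    have h5 : (t ^ μ) ^ n = t ^ (μ * n) := by
      rw [Real.rpow_mul ht0.le, Real.rpow_natCast]
    have h6 : t ^ (μ * n) * t ^ (-T s) ≤ t ^ (-(T d / 4)) * t ^ (-(T s / 2)) := by
      rw [← Real.rpow_add ht0, ← Real.rpow_add ht0]
      refine Real.rpow_le_rpow_of_exponent_le ht ?_
      have := hTanti hs.le
      linarith
    have h7 : 0 < t ^ (-(T s / 2)) := Real.rpow_pos_of_pos ht0 _
    have h8 : 0 < t ^ (μ * n) * t ^ (-T s) := by positivity
    simp only [h4, h5]
    rcases le_or_gt C 0 with hC | hC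
    · have : C * t ^ (μ * n) * t ^ (-T s) ≤ 0 := by
        rw [mul_assoc]; exact mul_nonpos_of_nonpos_of_nonneg hC h8.le
      linarith
    · calc C * t ^ (μ * n) * t ^ (-T s) = C * (t ^ (μ * n) * t ^ (-T s)) := by ring
        _ ≤ C * (t ^ (-(T d / 4)) * t ^ (-(T s / 2))) := by gcongr
        _ = C * t ^ (-(T d / 4)) * t ^ (-(T s / 2)) := by ring
        _ < 1 * t ^ (-(T s / 2)) := by gcongr
        _ = _ := one_mul _

/-! ### Chains of resonances stay in a dyadic shell. -/

/-- Two points of `S` are linked when their difference is an integer vector with which one of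
them is resonant. -/
def ResonanceLink {d : ℕ} (h : EuclideanSpace ℝ (Fin d) → ℝ) (δ μ R : ℝ)
    (S : Set (EuclideanSpace ℝ (Fin d))) (a b : EuclideanSpace ℝ (Fin d)) : Prop :=
  a ∈ S ∧ b ∈ S ∧ ∃ k : Fin d → ℤ, b - a = intVec k ∧
    (IsResonant h δ μ R a k ∨ IsResonant h δ μ R b (-k))

theorem ResonanceLink.symm {d : ℕ} {h : EuclideanSpace ℝ (Fin d) → ℝ} {δ μ R : ℝ}
    {S : Set (EuclideanSpace ℝ (Fin d))} {a b : EuclideanSpace ℝ (Fin d)}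
    (hab : ResonanceLink h δ μ R S a b) : ResonanceLink h δ μ R S b a := by
  obtain ⟨ha, hb, k, hk, hres⟩ := hab
  refine ⟨hb, ha, -k, by rw [intVec_neg, ← hk, neg_sub], ?_⟩
  rw [neg_neg]
  exact hres.symm

theorem exists_walk_of_reflTransGen {α : Type*} {r : α → α → Prop} {a b : α}
    (hab : Relation.ReflTransGen r a b) :
    ∃ (x : ℕ → α) (N : ℕ), x 0 = a ∧ x N = b ∧ ∀ i < N, r (x i) (x (i + 1)) := by
  induction hab with
  | refl => exact ⟨fun _ => a, 0, rfl, rfl, fun i hi => absurd hi i.not_lt_zero⟩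
  | @tail b c _ hbc ih =>
    obtain ⟨x, N, h0, hN, hx⟩ := ih
    refine ⟨fun i => if i ≤ N then x i else c, N + 1, by simpa using h0, by simp, ?_⟩
    intro i hi
    rcases Nat.lt_succ_iff_lt_or_eq.mp hi with h1 | rfl
    · simpa [h1.le, Nat.succ_le_of_lt h1] using hx i h1
    · simpa [hN] using hbc

theorem rpow_le_half {t μ : ℝ} (ht : 4 ≤ t) (hμ : μ ≤ 1 / 2) : t ^ μ ≤ t / 2 := by
  have h1 : t ^ μ ≤ √t := by
    rw [Real.sqrt_eq_rpow]
    exact Real.rpow_le_rpow_of_exponent_le (by linarith) hμ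
  have h2 : 2 ≤ √t := Real.le_sqrt_of_sq_le (by linarith)
  have h3 := Real.mul_self_sqrt (by linarith : 0 ≤ t)
  nlinarith

/-- The resonance may sit at `b`, whose norm is not bounded a priori. But `‖b‖ ≤ t + ‖b‖ ^ μ ≤ t +
‖b‖ / 2` for large `‖b‖`, whence `‖b‖ ≤ 2 t` and the factor 2. -/
theorem norm_intVec_le_of_isResonant {d : ℕ} {h : EuclideanSpace ℝ (Fin d) → ℝ} {δ μ R t : ℝ}
    {a b : EuclideanSpace ℝ (Fin d)} {k : Fin d → ℤ} (hμ : 0 < μ) (hμ1 : μ ≤ 1 / 2) (ht : 4 ≤ t)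
    (ha : ‖a‖ ≤ t) (hk : b - a = intVec k)
    (hres : IsResonant h δ μ R a k ∨ IsResonant h δ μ R b (-k)) : ‖intVec k‖ ≤ 2 * t ^ μ := by
  have htμ : 0 < t ^ μ := Real.rpow_pos_of_pos (by linarith) _
  rcases hres with hres | hres
  · have := Real.rpow_le_rpow (norm_nonneg _) ha hμ.le
    linarith [hres.2.1]
  · have h1 := hres.2.1
    rw [intVec_neg, norm_neg] at h1
    have h2 : ‖b‖ ≤ ‖a‖ + ‖intVec k‖ := by
      rw [← hk]; exact norm_le_norm_add_norm_sub' b a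
    have h3 : ‖b‖ ≤ 2 * t := by
      by_contra! h4
      linarith [rpow_le_half (by linarith : 4 ≤ ‖b‖) hμ1]
    calc ‖intVec k‖ ≤ (2 * t) ^ μ := h1.trans (Real.rpow_le_rpow (norm_nonneg _) h3 hμ.le)
      _ = 2 ^ μ * t ^ μ := Real.mul_rpow (by norm_num) (by linarith)
      _ ≤ 2 ^ (1 : ℝ) * t ^ μ := by
        gcongr
        · norm_num
        · linarith
      _ = 2 * t ^ μ := by rw [Real.rpow_one]

theorem abs_inner_le_of_isResonant {d : ℕ} {h : EuclideanSpace ℝ (Fin d) → ℝ} {δ μ R t m : ℝ}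
    {a z : EuclideanSpace ℝ (Fin d)} {k : Fin d → ℤ} (ht : 0 < t) (hδ : 0 ≤ δ) (ha : ‖a‖ ≤ t)
    (hz : gradient h a = t ^ (m - 1) • z) (hres : IsResonant h δ μ R a k) :
    |inner ℝ z (intVec k)| ≤ t ^ (-(m - 1 - δ)) * ‖intVec k‖ := by
  have h1 := hres.1.le
  have htm : 0 < t ^ (m - 1) := Real.rpow_pos_of_pos ht _
  rw [hz, real_inner_smul_left, abs_mul, abs_of_pos htm] at h1
  have h2 : ‖a‖ ^ δ ≤ t ^ (m - 1) * t ^ (-(m - 1 - δ)) := by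
    rw [← Real.rpow_add ht]
    calc ‖a‖ ^ δ ≤ t ^ δ := Real.rpow_le_rpow (norm_nonneg _) ha hδ
      _ = _ := by ring_nf
  refine le_of_mul_le_mul_left (h1.trans ?_) htm
  rw [← mul_assoc]
  gcongr

/-- Chains of resonances issued from a large point do not leave a ball of comparable radius. -/
theorem AssumptionL.norm_sub_le_of_reflTransGen {d : ℕ}
    {𝒞 : ProperCone ℝ (EuclideanSpace ℝ (Fin d))} {m : ℝ} {h : EuclideanSpace ℝ (Fin d) → ℝ}
    (hL : AssumptionL 𝒞 m h) {δ : ℝ} (hδ0 : 0 ≤ δ) (hδ : δ < m - 1) :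
    ∃ μ₀ : ℝ, 0 < μ₀ ∧ μ₀ ≤ 1 / 2 ∧ ∀ μ : ℝ, 0 < μ → μ < μ₀ → ∃ R' : ℝ, 1 ≤ R' ∧
      ∀ (R : ℝ) (S : Set (EuclideanSpace ℝ (Fin d))), S ⊆ 𝒞 → ∀ a ∈ S, R' ≤ ‖a‖ → ∀ b,
        Relation.ReflTransGen (ResonanceLink h δ μ R S) a b → ‖b - a‖ ≤ ‖a‖ / 2 := by
  obtain ⟨g, l, t₀, C, β, r, hl, ht₀, hC, hβ, hr, hlip, hgrad, hsteep⟩ :=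
    hL.exists_rescaled_gradient
  obtain ⟨μ₀, hμ₀, hμ₀1, hscales⟩ := exists_scales (τ := m - 1 - δ) (β := β) (r := min r (1 / 16))
    (2 * d + 2) d (by linarith) hβ (by positivity)
    (C * ((d ^ 2 * d.factorial : ℕ) * 2 ^ (2 * d + 2) * (1 + 2 * l))) (2 + 2 * l)
  refine ⟨μ₀, hμ₀, hμ₀1, fun μ hμ hμμ₀ => ?_⟩
  obtain ⟨Λ, hΛ⟩ := Filter.eventually_atTop.mp (hscales μ hμ hμμ₀)
  refine ⟨max (max 4 t₀) (max 1 Λ), (le_max_left 1 Λ).trans (le_max_right _ _), ?_⟩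
  intro R S hS a ha haR b hab
  simp only [max_le_iff] at haR
  obtain ⟨⟨ha4, hat₀⟩, ha1, haΛ⟩ := haR
  -- The rescaled walk starts at norm `3 / 4`, the middle of the annulus, at distance `1 / 8` from
  -- both bounding radii.
  set t := 4 / 3 * ‖a‖ with ht
  have hat : ‖a‖ ≤ t := by linarith
  have ht0 : 0 < t := by linarith
  have ht1 : 1 ≤ t := by linarith
  obtain ⟨ξ, hξ0, hξmono, hξd, hξA, hξ⟩ := hΛ t (by linarith)
  obtain ⟨y, N, hy0, hyN, hy⟩ := exists_walk_of_reflTransGen hab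
  choose k hk using fun i : ℕ => (show ∃ k : Fin d → ℤ, i < N → y (i + 1) - y i = intVec k ∧
      (IsResonant h δ μ R (y i) k ∨ IsResonant h δ μ R (y (i + 1)) (-k)) by
    by_cases hi : i < N
    · obtain ⟨-, -, k, hk⟩ := hy i hi
      exact ⟨k, fun _ => hk⟩
    · exact ⟨0, fun h => absurd h hi⟩)
  set x : ℕ → EuclideanSpace ℝ (Fin d) := fun i => t⁻¹ • y i with hx
  have hyx : ∀ i, t • x i = y i := fun i => smul_inv_smul₀ ht0.ne' _
  have hnorm : ∀ z : EuclideanSpace ℝ (Fin d), ‖t⁻¹ • z‖ = ‖z‖ / t := fun z => by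
    rw [norm_smul, Real.norm_eq_abs, abs_of_pos (inv_pos.mpr ht0), inv_mul_eq_div]
  have hx0 : ‖x 0‖ = 3 / 4 := by
    rw [hx]; simp only; rw [hnorm, hy0, ht]; field_simp
  have hyS : ∀ i ≤ N, y i ∈ S := by
    intro i hi
    rcases i with _ | i
    · rwa [hy0]
    · exact (hy i hi).2.1
  have hmem : ∀ i ≤ N, ‖x i - x 0‖ ≤ 1 / 8 → x i ∈ coneAnnulus 𝒞 := by
    intro i hi hxi
    refine ⟨𝒞.smul_mem (hS (hyS i hi)) (inv_nonneg.mpr ht0.le), ?_, ?_⟩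
    · have := norm_le_norm_add_norm_sub (x i) (x 0); linarith
    · have := norm_le_norm_add_norm_sub' (x i) (x 0); linarith
  have hxnorm : ∀ i, x i ∈ coneAnnulus 𝒞 → ‖y i‖ ≤ t := by
    intro i hi
    have h1 := hi.2.2
    rw [hx] at h1
    simp only at h1
    rw [hnorm, div_le_iff₀ ht0] at h1
    linarith
  have hstep : ∀ i < N, x (i + 1) - x i = t⁻¹ • intVec (k i) := by
    intro i hi
    rw [← ((hk i hi).1), hx]; simp only; rw [smul_sub]
  have htμ : t ^ (μ - 1) = t ^ μ / t := by rw [Real.rpow_sub_one ht0.ne']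
  have htμ0 : 0 < t ^ (μ - 1) := Real.rpow_pos_of_pos ht0 _
  have htτ0 : 0 < t ^ (-(m - 1 - δ)) := Real.rpow_pos_of_pos ht0 _
  -- The second term pays for moving a resonance from the far end of a step to its start.
  have hρ : t ^ (-(m - 1 - δ)) + l * (2 * t ^ (μ - 1)) ≤ ξ 0 := by
    refine le_trans ?_ hξA
    nlinarith [mul_nonneg hl htμ0.le, mul_nonneg hl htτ0.le]
  have hstep2 : 2 * t ^ (μ - 1) ≤ ξ 0 := by
    refine le_trans ?_ hξA
    nlinarith [mul_nonneg hl htμ0.le, mul_nonneg hl htτ0.le]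
  have hξ016 : ξ 0 ≤ 1 / 16 := (hξmono d.zero_le).trans (hξd.trans (min_le_right _ _))
  have hkQ : ∀ i < N, x i ∈ coneAnnulus 𝒞 → ‖intVec (k i)‖ ≤ 2 * t ^ μ := fun i hi hmi =>
    norm_intVec_le_of_isResonant hμ (by linarith) (by linarith) (hxnorm i hmi) (hk i hi).1
      (hk i hi).2
  have hstepnorm : ∀ i < N, x i ∈ coneAnnulus 𝒞 → ‖x (i + 1) - x i‖ ≤ 2 * t ^ (μ - 1) := by
    intro i hi hmi
    rw [hstep i hi, hnorm, htμ, ← mul_div_assoc]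
    exact div_le_div_of_nonneg_right (hkQ i hi hmi) ht0.le
  have hlipK : ∀ u ∈ coneAnnulus 𝒞, ∀ v ∈ coneAnnulus 𝒞, ‖g u - g v‖ ≤ l * ‖u - v‖ :=
    fun u hu v hv => hlip u v (by linarith [hu.2.2]) (by linarith [hv.2.2])
  have hgy : ∀ i, x i ∈ coneAnnulus 𝒞 → gradient h (y i) = t ^ (m - 1) • g (x i) := by
    intro i hi
    rw [← hyx i]
    exact hgrad t (by linarith) _ (by linarith [hi.2.1])
  have hres : ∀ i < N, x i ∈ coneAnnulus 𝒞 → x (i + 1) ∈ coneAnnulus 𝒞 →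
      |inner ℝ (g (x i)) (intVec (k i))| ≤
        (t ^ (-(m - 1 - δ)) + l * (2 * t ^ (μ - 1))) * ‖intVec (k i)‖ := by
    intro i hi hmi hmi'
    rcases (hk i hi).2 with hr1 | hr1
    · refine (abs_inner_le_of_isResonant ht0 hδ0 (hxnorm i hmi) (hgy i hmi) hr1).trans ?_
      gcongr
      exact le_add_of_nonneg_right (by positivity)
    · have h1 := abs_inner_le_of_isResonant ht0 hδ0 (hxnorm _ hmi') (hgy _ hmi') hr1
      rw [intVec_neg, inner_neg_right, abs_neg, norm_neg] at h1
      have h2 : inner ℝ (g (x i)) (intVec (k i)) = inner ℝ (g (x (i + 1))) (intVec (k i)) -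
          inner ℝ (g (x (i + 1)) - g (x i)) (intVec (k i)) := by rw [inner_sub_left]; ring
      rw [h2, add_mul]
      refine (abs_sub _ _).trans (add_le_add h1 ((abs_real_inner_le_norm _ _).trans ?_))
      gcongr
      exact (hlipK _ hmi' _ hmi).trans (mul_le_mul_of_nonneg_left (hstepnorm i hi hmi) hl)
  -- Bootstrap: a walk within `1 / 16` of its start is still within `1 / 8` after one more step,
  -- hence in the annulus, and confinement restores `1 / 16`.
  have hconf : ∀ n ≤ N, ∀ i ≤ n, ‖x i - x 0‖ ≤ 1 / 16 := by
    intro n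
    induction n with
    | zero =>
      intro _ i hi
      obtain rfl : i = 0 := by omega
      simp
    | succ n ih =>
      intro hn i hi
      replace ih := ih (by omega)
      rcases Nat.lt_or_ge i (n + 1) with hi' | hi'
      · exact ih i (by omega)
      obtain rfl : i = n + 1 := by omega
      have hKn : ∀ j ≤ n, x j ∈ coneAnnulus 𝒞 := fun j hj =>
        hmem j (by omega) ((ih j hj).trans (by norm_num))
      have hK : ∀ j ≤ n + 1, x j ∈ coneAnnulus 𝒞 := by
        intro j hj
        rcases Nat.lt_or_ge j (n + 1) with hj' | hj'
        · exact hKn j (by omega)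
        obtain rfl : j = n + 1 := by omega
        refine hmem _ hn ?_
        have h1 := norm_sub_le_norm_sub_add_norm_sub (x (n + 1)) (x n) (x 0)
        have h2 := hstepnorm n (by omega) (hKn n le_rfl)
        have h3 := ih n le_rfl
        linarith
      have := norm_sub_le_of_resonant_walk hsteep hl hlipK (Q := 2 * t ^ μ)
        (by linarith [Real.one_le_rpow ht1 hμ.le]) hL.one_le_dim hK
        (fun j hj => hstep j (by omega))
        (fun j hj => hkQ j (by omega) (hK j hj.le)) (fun j hj => hres j (by omega) (hK j hj.le)
          (hK (j + 1) hj)) hξ0 hξmono (hξd.trans (min_le_left _ _)) hρ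
        (fun j hj => (hstepnorm j (by omega) (hK j hj.le)).trans hstep2)
        (fun s hs => by
          refine lt_of_eq_of_lt ?_ (hξ s hs)
          rw [mul_pow]; ring)
        d le_rfl 0 (n + 1) (by omega) le_rfl (by simpa using Submodule.finrank_le (stepSpan k 0 (n + 1)))
      exact this.trans (hξd.trans (min_le_right _ _))
  have h1 := hconf N le_rfl N le_rfl
  have h2 : x N - x 0 = t⁻¹ • (b - a) := by rw [← hyN, ← hy0, smul_sub]
  rw [h2, hnorm, div_le_iff₀ ht0] at h1
  linarith

/-! ### Closeness in position and energy implies resonance. -/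

/-- By homogeneity the gradient has Lipschitz constant of order `‖a‖ ^ (m - 2)` near `a`; the mean
value inequality then gives the quadratic remainder. -/
theorem AssumptionL.abs_sub_sub_inner_gradient_le {d : ℕ}
    {𝒞 : ProperCone ℝ (EuclideanSpace ℝ (Fin d))} {m : ℝ} {h : EuclideanSpace ℝ (Fin d) → ℝ}
    (hL : AssumptionL 𝒞 m h) :
    ∃ l t₀ : ℝ, 0 ≤ l ∧ 1 ≤ t₀ ∧ ∀ a v : EuclideanSpace ℝ (Fin d), t₀ ≤ ‖a‖ → ‖v‖ ≤ ‖a‖ / 2 →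
      |h (a + v) - h a - inner ℝ (gradient h a) v| ≤ l * ‖a‖ ^ (m - 2) * ‖v‖ ^ 2 := by
  obtain ⟨g, l, t₀, -, -, -, hl, ht₀, -, -, -, hlip, hgrad, -⟩ := hL.exists_rescaled_gradient
  refine ⟨l, t₀, hl, ht₀, fun a v ha hv => ?_⟩
  set t := ‖a‖ with ht
  have ht0 : 0 < t := by linarith
  have hdiff : Differentiable ℝ h := hL.smooth.differentiable (by simp)
  have hnorm : ∀ z : EuclideanSpace ℝ (Fin d), ‖t⁻¹ • z‖ = ‖z‖ / t := fun z => by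
    rw [norm_smul, Real.norm_eq_abs, abs_of_pos (inv_pos.mpr ht0), inv_mul_eq_div]
  have hball : ∀ c ∈ Metric.closedBall a ‖v‖,
      ‖fderiv ℝ h c - fderiv ℝ h a‖ ≤ l * t ^ (m - 2) * ‖v‖ := by
    intro c hc
    rw [mem_closedBall_iff_norm] at hc
    have hc1 : t / 2 ≤ ‖c‖ := by
      have := norm_le_norm_add_norm_sub c a; linarith
    have hc2 : ‖c‖ ≤ 2 * t := by
      have := norm_le_norm_add_norm_sub' c a; linarith
    have hgr : ∀ z : EuclideanSpace ℝ (Fin d), t / 2 ≤ ‖z‖ →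
        gradient h z = t ^ (m - 1) • g (t⁻¹ • z) := by
      intro z hz
      have h1 := hgrad t ha (t⁻¹ • z) (by rw [hnorm, lt_div_iff₀ ht0]; linarith)
      rwa [smul_inv_smul₀ ht0.ne'] at h1
    rw [← toDual_gradient, ← toDual_gradient, ← map_sub, LinearIsometryEquiv.norm_map,
      hgr c hc1, hgr a (by linarith), ← smul_sub, norm_smul, Real.norm_eq_abs,
      abs_of_pos (Real.rpow_pos_of_pos ht0 _)]
    have h2 := hlip (t⁻¹ • c) (t⁻¹ • a) (by rw [hnorm, div_le_iff₀ ht0]; linarith)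
      (by rw [hnorm, div_le_iff₀ ht0]; linarith)
    rw [← smul_sub, hnorm] at h2
    have h3 : t ^ (m - 1) = t ^ (m - 2) * t := by
      rw [← Real.rpow_add_one ht0.ne']; ring_nf
    calc t ^ (m - 1) * ‖g (t⁻¹ • c) - g (t⁻¹ • a)‖
        ≤ t ^ (m - 2) * t * (l * (‖v‖ / t)) := by rw [h3]; gcongr; exact h2.trans (by gcongr)
      _ = _ := by field_simp
  have := (convex_closedBall a ‖v‖).norm_image_sub_le_of_norm_hasFDerivWithin_le'
    (f := h) (f' := fderiv ℝ h) (φ := fderiv ℝ h a) (x := a) (y := a + v) (𝕜 := ℝ)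
    (fun z _ => (hdiff z).hasFDerivAt.hasFDerivWithinAt) hball (by simp) (by simp)
  rw [add_sub_cancel_left, ← inner_gradient_left, Real.norm_eq_abs] at this
  exact this.trans_eq (by ring)

/-- Two lattice points which are close to each other in position and energy are resonant. -/
theorem AssumptionL.isResonant_of_close {d : ℕ}
    {𝒞 : ProperCone ℝ (EuclideanSpace ℝ (Fin d))} {m : ℝ} {h : EuclideanSpace ℝ (Fin d) → ℝ}
    (hL : AssumptionL 𝒞 m h) {δ μ : ℝ} (hμ : 0 < μ) (hμ1 : μ ≤ 1 / 2) (hμδ : μ < δ)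
    (hmδ : m - 2 + μ < δ) :
    ∃ R₁ : ℝ, ∀ (R : ℝ) (a b : EuclideanSpace ℝ (Fin d)) (k : Fin d → ℤ), b - a = intVec k →
      k ≠ 0 → R₁ ≤ ‖a‖ → R ≤ ‖a‖ → ‖b‖ ≤ ‖a‖ →
      ‖a - b‖ + |h a - h b| < 1 / 2 * (‖a‖ ^ μ + ‖b‖ ^ μ) → IsResonant h δ μ R a k := by
  obtain ⟨l, t₀, hl, ht₀, htaylor⟩ := hL.abs_sub_sub_inner_gradient_le
  obtain ⟨Λ, hΛ⟩ := Filter.eventually_atTop.mp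
    ((eventually_const_mul_rpow_neg_lt (sub_pos.mpr hμδ) 1 (b := 1 / 2) (by norm_num)).and
      (eventually_const_mul_rpow_neg_lt (sub_pos.mpr hmδ) l (b := 1 / 2) (by norm_num)))
  refine ⟨max (max 4 t₀) Λ, fun R a b k hk hk0 haR₁ haR hba hclose => ?_⟩
  simp only [max_le_iff] at haR₁
  obtain ⟨⟨ha4, hat₀⟩, haΛ⟩ := haR₁
  obtain ⟨h1, h2⟩ := hΛ _ haΛ
  set t := ‖a‖ with ht
  have ht0 : 0 < t := by linarith
  have hbμ : ‖b‖ ^ μ ≤ t ^ μ := Real.rpow_le_rpow (norm_nonneg _) hba hμ.le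
  have hkn : ‖a - b‖ = ‖intVec k‖ := by rw [← hk, norm_sub_rev]
  have hk1 := one_le_norm_intVec hk0
  have hkμ : ‖intVec k‖ ≤ t ^ μ := by linarith [abs_nonneg (h a - h b)]
  have hΔ : |h a - h b| ≤ t ^ μ := by linarith [norm_nonneg (a - b)]
  refine ⟨?_, hkμ, haR⟩
  have h3 := htaylor a (intVec k) hat₀ (hkμ.trans (rpow_le_half ha4 hμ1))
  have h4 : a + intVec k = b := by rw [← hk]; abel
  rw [h4] at h3
  have h5 : |inner ℝ (gradient h a) (intVec k)| ≤
      t ^ μ + l * t ^ (m - 2) * ‖intVec k‖ ^ 2 := by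
    rw [abs_sub_comm] at hΔ
    have h6 : inner ℝ (gradient h a) (intVec k) =
        (h b - h a) - (h b - h a - inner ℝ (gradient h a) (intVec k)) := by ring
    rw [h6]
    exact (abs_sub _ _).trans (add_le_add hΔ h3)
  have hδ0 : 0 < t ^ δ := Real.rpow_pos_of_pos ht0 _
  have h7 : t ^ μ = t ^ (-(δ - μ)) * t ^ δ := by rw [← Real.rpow_add ht0]; ring_nf
  have h8 : t ^ (m - 2) * t ^ μ = t ^ (-(δ - (m - 2 + μ))) * t ^ δ := by
    rw [← Real.rpow_add ht0, ← Real.rpow_add ht0]; ring_nf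
  have htm : 0 < t ^ (m - 2) := Real.rpow_pos_of_pos ht0 _
  -- Both terms are `o(t ^ δ) ‖k‖`: the first since `1 ≤ ‖k‖` and `μ < δ`, the second since `‖k‖ ≤ t
  -- ^ μ` and `m - 2 + μ < δ`.
  calc |inner ℝ (gradient h a) (intVec k)| ≤ t ^ μ + l * t ^ (m - 2) * ‖intVec k‖ ^ 2 := h5
    _ ≤ t ^ μ * ‖intVec k‖ + l * t ^ (m - 2) * (‖intVec k‖ * t ^ μ) := by
        refine add_le_add (le_mul_of_one_le_right (by positivity) hk1) ?_
        rw [sq]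
        gcongr
    _ = (t ^ μ + l * (t ^ (m - 2) * t ^ μ)) * ‖intVec k‖ := by ring
    _ = (1 * t ^ (-(δ - μ)) + l * t ^ (-(δ - (m - 2 + μ)))) * t ^ δ * ‖intVec k‖ := by
        rw [h8]; nth_rewrite 1 [h7]; ring
    _ < 1 * t ^ δ * ‖intVec k‖ := by
        gcongr
        linarith
    _ = _ := by rw [one_mul]

/-! ### Modules as labels, and separation of unlinked points. -/

theorem IsResonant.ne_zero {d : ℕ} {h : EuclideanSpace ℝ (Fin d) → ℝ} {δ μ R : ℝ}
    {a : EuclideanSpace ℝ (Fin d)} {k : Fin d → ℤ} (hres : IsResonant h δ μ R a k) : k ≠ 0 := by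
  rintro rfl
  simpa [intVec_zero] using hres.1

theorem span_intVec_saturation {d : ℕ} (s : Set (Fin d → ℤ)) :
    Submodule.span ℝ (intVec '' {k | intVec k ∈ Submodule.span ℝ (intVec '' s)}) =
      Submodule.span ℝ (intVec '' s) := by
  refine le_antisymm (Submodule.span_le.mpr ?_) (Submodule.span_mono (Set.image_mono ?_))
  · rintro _ ⟨k, hk, rfl⟩
    exact hk
  · exact fun k hk => Submodule.subset_span ⟨k, hk, rfl⟩

/-- The smallest module that contains `s`. -/
def LatticeModule.saturation {d : ℕ} (s : Set (Fin d → ℤ)) : LatticeModule d where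
  carrier := {k | intVec k ∈ Submodule.span ℝ (intVec '' s)}
  saturated k := by rw [span_intVec_saturation, Set.mem_ofPred_eq]

theorem LatticeModule.subset_saturation {d : ℕ} (s : Set (Fin d → ℤ)) :
    s ⊆ (LatticeModule.saturation s).carrier :=
  fun k hk => Submodule.subset_span ⟨k, hk, rfl⟩

theorem LatticeModule.dim_saturation {d : ℕ} (s : Set (Fin d → ℤ)) :
    (LatticeModule.saturation s).dim = Module.finrank ℝ (Submodule.span ℝ (intVec '' s)) := by
  rw [LatticeModule.dim, ← span_intVec_saturation s]
  rfl

theorem LatticeModule.one_le_dim_saturation {d : ℕ} {s : Set (Fin d → ℤ)} {k : Fin d → ℤ}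
    (hk : k ∈ s) (hk0 : k ≠ 0) : 1 ≤ (LatticeModule.saturation s).dim := by
  rw [dim_saturation]
  refine Submodule.one_le_finrank_iff.mpr fun h => ?_
  have h1 : intVec k ∈ Submodule.span ℝ (intVec '' s) := Submodule.subset_span ⟨k, hk, rfl⟩
  rw [h, Submodule.mem_bot] at h1
  have h2 := one_le_norm_intVec hk0
  rw [h1, norm_zero] at h2
  linarith

theorem LatticeModule.dim_saturation_empty {d : ℕ} :
    (LatticeModule.saturation (∅ : Set (Fin d → ℤ))).dim = 0 := by
  rw [dim_saturation, Set.image_empty, Submodule.span_empty, finrank_bot]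

theorem IsQuantumActions.exists_intVec {d : ℕ} {H : Type*} [NormedAddCommGroup H]
    [InnerProductSpace ℂ H] [CompleteSpace H] {A : Fin d → (H →ₗ.[ℂ] H)}
    {κ : EuclideanSpace ℝ (Fin d)} {𝒞 : ProperCone ℝ (EuclideanSpace ℝ (Fin d))}
    (hA : IsQuantumActions A κ 𝒞) {a b : EuclideanSpace ℝ (Fin d)} (ha : a ∈ jointSpectrum A)
    (hb : b ∈ jointSpectrum A) : ∃ k : Fin d → ℤ, b - a = intVec k := by
  obtain ⟨k, rfl⟩ := hA.lattice a ha
  obtain ⟨k', rfl⟩ := hA.lattice b hb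
  exact ⟨k' - k, by rw [intVec_sub]; abel⟩

theorem IsQuantumActions.countable_jointSpectrum {d : ℕ} {H : Type*} [NormedAddCommGroup H]
    [InnerProductSpace ℂ H] [CompleteSpace H] {A : Fin d → (H →ₗ.[ℂ] H)}
    {κ : EuclideanSpace ℝ (Fin d)} {𝒞 : ProperCone ℝ (EuclideanSpace ℝ (Fin d))}
    (hA : IsQuantumActions A κ 𝒞) : (jointSpectrum A).Countable := by
  refine (Set.countable_range fun k : Fin d → ℤ => intVec k + κ).mono fun a ha => ?_
  obtain ⟨k, rfl⟩ := hA.lattice a ha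
  exact ⟨k, rfl⟩

theorem exists_separation {d : ℕ} {H : Type*} [NormedAddCommGroup H]
    [InnerProductSpace ℂ H] [CompleteSpace H] {A : Fin d → (H →ₗ.[ℂ] H)}
    {κ : EuclideanSpace ℝ (Fin d)} {𝒞 : ProperCone ℝ (EuclideanSpace ℝ (Fin d))}
    (hA : IsQuantumActions A κ 𝒞) {h : EuclideanSpace ℝ (Fin d) → ℝ} {δ μ R₁ : ℝ} (hμ : 0 < μ)
    (R : ℝ) (hsep : ∀ (R : ℝ) (a b : EuclideanSpace ℝ (Fin d)) (k : Fin d → ℤ),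
      b - a = intVec k → k ≠ 0 → R₁ ≤ ‖a‖ → R ≤ ‖a‖ → ‖b‖ ≤ ‖a‖ →
      ‖a - b‖ + |h a - h b| < 1 / 2 * (‖a‖ ^ μ + ‖b‖ ^ μ) → IsResonant h δ μ R a k) :
    ∃ K : ℝ, 0 < K ∧ ∀ a ∈ jointSpectrum A, ∀ b ∈ jointSpectrum A, a ≠ b → ‖b‖ ≤ ‖a‖ →
      ¬ ResonanceLink h δ μ R (jointSpectrum A) a b →
        K * (‖a‖ ^ μ + ‖b‖ ^ μ) ≤ ‖a - b‖ + |h a - h b| := by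
  set ρ := max (max R₁ R) 1 with hρ
  have hρ0 : 0 < ρ := lt_max_of_lt_right one_pos
  have hρμ : 0 < ρ ^ μ := Real.rpow_pos_of_pos hρ0 _
  -- The second bound serves the points with `‖a‖ < ρ`, for which it is enough that distinct lattice
  -- points are at distance at least one.
  refine ⟨min (1 / 2) (1 / (2 * ρ ^ μ)), by positivity, fun a ha b hb hab hba hlink => ?_⟩
  obtain ⟨k, hk⟩ := hA.exists_intVec ha hb
  have hk0 : k ≠ 0 := by
    rintro rfl
    rw [intVec_zero, sub_eq_zero] at hk
    exact hab hk.symm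
  have hbμ : ‖b‖ ^ μ ≤ ‖a‖ ^ μ := Real.rpow_le_rpow (norm_nonneg _) hba hμ.le
  have hb0 : 0 ≤ ‖b‖ ^ μ := Real.rpow_nonneg (norm_nonneg _) _
  rcases le_or_gt ρ ‖a‖ with hlarge | hsmall
  · by_contra! hlt
    refine hlink ⟨ha, hb, k, hk, .inl (hsep R a b k hk hk0 ?_ ?_ hba (hlt.trans_le ?_))⟩
    · exact ((le_max_left _ _).trans (le_max_left _ _)).trans hlarge
    · exact ((le_max_right _ _).trans (le_max_left _ _)).trans hlarge
    · gcongr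
      exact min_le_left _ _
  · have haμ : ‖a‖ ^ μ ≤ ρ ^ μ := Real.rpow_le_rpow (norm_nonneg _) hsmall.le hμ.le
    have h1 : 1 ≤ ‖a - b‖ := by
      rw [norm_sub_rev, hk]; exact one_le_norm_intVec hk0
    calc min (1 / 2) (1 / (2 * ρ ^ μ)) * (‖a‖ ^ μ + ‖b‖ ^ μ)
        ≤ 1 / (2 * ρ ^ μ) * (ρ ^ μ + ρ ^ μ) := by
          gcongr
          · exact min_le_right _ _
          · linarith
      _ = 1 := by field_simp; ring
      _ ≤ _ := by linarith [abs_nonneg (h a - h b)]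

/-! ### Resonance classes and the partition. -/

/-- The equivalence relation generated by the resonance links. -/
def resonanceSetoid {d : ℕ} (h : EuclideanSpace ℝ (Fin d) → ℝ) (δ μ R : ℝ)
    (S : Set (EuclideanSpace ℝ (Fin d))) : Setoid (EuclideanSpace ℝ (Fin d)) where
  r := Relation.ReflTransGen (ResonanceLink h δ μ R S)
  iseqv := ⟨fun _ => .refl, (@Relation.ReflTransGen.stdSymm _ _ ⟨fun _ _ => ResonanceLink.symm⟩).symm _ _,
    fun hab hbc => hab.trans hbc⟩

theorem mem_of_reflTransGen_resonanceLink {d : ℕ} {h : EuclideanSpace ℝ (Fin d) → ℝ} {δ μ R : ℝ}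
    {S : Set (EuclideanSpace ℝ (Fin d))} {a b : EuclideanSpace ℝ (Fin d)} (ha : a ∈ S)
    (hab : Relation.ReflTransGen (ResonanceLink h δ μ R S) a b) : b ∈ S := by
  rcases hab.cases_tail with rfl | ⟨c, -, hc⟩
  exacts [ha, hc.2.1]

/-- Keeps nontrivial classes away from the origin, where no dyadic bound could hold. -/
theorem two_le_norm_of_resonanceLink {d : ℕ} {h : EuclideanSpace ℝ (Fin d) → ℝ} {δ μ R : ℝ}
    {S : Set (EuclideanSpace ℝ (Fin d))} {a b : EuclideanSpace ℝ (Fin d)} (hμ : μ ≤ 1 / 2)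
    (hR : 4 ≤ R) (hab : ResonanceLink h δ μ R S a b) : 2 ≤ ‖b‖ := by
  obtain ⟨-, -, k, hk, hres | hres⟩ := hab
  · have ha := hR.trans hres.2.2
    have h1 := hres.2.1.trans (rpow_le_half ha hμ)
    rw [← hk] at h1
    have := norm_le_norm_add_norm_sub b a
    linarith
  · linarith [hres.2.2]

/-- A countable set with an equivalence relation is split into labelled, numbered classes. -/
theorem exists_labelled_classes {α β : Type*} {S : Set α} (hS : S.Countable) (s : Setoid α)
    (hsS : ∀ a b, s a b → a ∈ S → b ∈ S) (L : α → β)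
    (hL : ∀ a b, s a b → L a = L b) :
    ∃ E : β → ℕ → Set α, (⋃ M, ⋃ j, E M j) = S ∧
      (∀ M j M' j' a, a ∈ E M j → a ∈ E M' j' → (M, j) = (M', j')) ∧
      (∀ M j, ∀ a ∈ E M j, L a = M) ∧
      (∀ M j, ∀ a ∈ E M j, ∀ b ∈ E M j, s a b) ∧
      (∀ M j, ∀ a ∈ E M j, ∀ b, s a b → b ∈ E M j) := by
  obtain ⟨f, hf⟩ := Set.countable_iff_exists_injOn.mp hS
  set rep : α → α := fun a => (Quotient.mk s a).out with hrep
  have hrel : ∀ a, s a (rep a) := fun a => s.symm (Quotient.mk_out (s := s) a)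
  -- The number of a class is the code of its chosen representative, so many blocks may be empty.
  refine ⟨fun M j => {a | a ∈ S ∧ L a = M ∧ f (rep a) = j}, ?_, ?_, fun M j a ha => ha.2.1, ?_, ?_⟩
  · ext a
    simp
  · rintro M j M' j' a ⟨-, rfl, rfl⟩ ⟨-, rfl, rfl⟩
    rfl
  · rintro M j a ⟨ha, -, haj⟩ b ⟨hb, -, hbj⟩
    have h1 := hf (hsS _ _ (hrel a) ha) (hsS _ _ (hrel b) hb) (haj.trans hbj.symm)
    exact s.trans (hrel a) (h1 ▸ s.symm (hrel b))
  · rintro M j a ⟨ha, hM, haj⟩ b hab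
    refine ⟨hsS _ _ hab ha, (hL a b hab).symm.trans hM, ?_⟩
    have h1 : Quotient.mk s a = Quotient.mk s b := Quotient.sound hab
    rw [← haj, hrep]
    simp only [h1]

theorem theorem7p4 {d : ℕ} {H : Type*} [NormedAddCommGroup H] [InnerProductSpace ℂ H]
    [CompleteSpace H] (A : Fin d → (H →ₗ.[ℂ] H)) (κ : EuclideanSpace ℝ (Fin d))
    (𝒞 : ProperCone ℝ (EuclideanSpace ℝ (Fin d))) (hA : IsQuantumActions A κ 𝒞)
    (m : ℝ) (h : EuclideanSpace ℝ (Fin d) → ℝ) (hL : AssumptionL 𝒞 m h) :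
    ∃ δ₀ R₀ : ℝ, 0 < δ₀ ∧ δ₀ < m - 1 ∧ 0 < R₀ ∧
      ∀ δ : ℝ, δ₀ < δ → δ < m - 1 →
        ∃ μ₀ : ℝ, 0 < μ₀ ∧ ∀ μ : ℝ, 0 < μ → μ < μ₀ → ∀ R : ℝ, R₀ < R →
          ∃ E : LatticeModule d → ℕ → Set (EuclideanSpace ℝ (Fin d)),
            -- the blocks form a partition of the joint spectrum
            (⋃ M, ⋃ j, E M j) = jointSpectrum A ∧
            (∀ M j M' j', (M, j) ≠ (M', j') → Disjoint (E M j) (E M' j')) ∧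
            -- (i) the blocks are dyadic
            (∃ C : ℝ, 0 < C ∧ ∀ M j, ∀ a ∈ E M j, ∀ b ∈ E M j, ‖a‖ ≤ C * ‖b‖) ∧
            -- (ii) resonances and blocks
            (∀ M j, 1 ≤ M.dim → ∀ a ∈ E M j, ∃ k ∈ M.carrier, IsResonant h δ μ R a k) ∧
            (∀ M j, M.dim = 0 → (E M j).Nonempty →
              ∃ a ∈ E M j, ∀ k : Fin d → ℤ, ¬ IsResonant h δ μ R a k) ∧
            (∀ M j, ∀ a ∈ E M j, ∀ k : Fin d → ℤ, IsResonant h δ μ R a k →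
              a + intVec k ∈ jointSpectrum A → a + intVec k ∈ E M j) ∧
            -- (iii) different blocks are separated
            (∃ K : ℝ, 0 < K ∧ ∀ M j M' j', (M, j) ≠ (M', j') →
              ∀ a ∈ E M j, ∀ b ∈ E M' j',
                K * (‖a‖ ^ μ + ‖b‖ ^ μ) ≤ ‖a - b‖ + |h a - h b|) := by
  classical
  have hm := hL.one_lt_degree
  set Λ := jointSpectrum A with hΛ
  -- With `μ < (m - 1) / 2` and `μ ≤ 1 / 2` these give `μ < δ` and `m - 2 + μ < δ`, as separation
  -- requires. The value 4 is the threshold of `two_le_norm_of_resonanceLink`.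
  refine ⟨max ((m - 1) / 2) (m - 3 / 2), 4, lt_max_of_lt_left (by linarith),
    max_lt (by linarith) (by linarith), by norm_num, fun δ hδ₀ hδ => ?_⟩
  have hδ1 := (le_max_left _ _).trans_lt hδ₀
  have hδ2 := (le_max_right _ _).trans_lt hδ₀
  obtain ⟨μ₀, hμ₀, hμ₀1, hconf⟩ := hL.norm_sub_le_of_reflTransGen (δ := δ) (by linarith) hδ
  refine ⟨min μ₀ ((m - 1) / 2), lt_min hμ₀ (by linarith), fun μ hμ hμμ₀ R hR => ?_⟩
  have hμ1 := hμμ₀.trans_le (min_le_left _ _)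
  have hμ2 := hμμ₀.trans_le (min_le_right _ _)
  have hμh : μ ≤ 1 / 2 := by linarith
  obtain ⟨R', hR', hconf⟩ := hconf μ hμ hμ1
  replace hconf := hconf R Λ fun a ha => hA.cone a ha
  obtain ⟨R₁, hsep⟩ := hL.isResonant_of_close hμ hμh (by linarith : μ < δ) (by linarith)
  set s := resonanceSetoid h δ μ R Λ with hs
  -- A class is labelled by the module generated by its resonances, provided that all its
  -- points are resonant.
  set L : EuclideanSpace ℝ (Fin d) → LatticeModule d := fun a =>
    if ∀ b, s a b → ∃ k, IsResonant h δ μ R b k then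
      LatticeModule.saturation {k | ∃ b, s a b ∧ IsResonant h δ μ R b k}
    else LatticeModule.saturation ∅ with hLdef
  have hLs : ∀ a b, s a b → L a = L b := by
    intro a b hab
    have h1 : ∀ c, s a c ↔ s b c := fun c =>
      ⟨fun hc => s.trans (s.symm hab) hc, fun hc => s.trans hab hc⟩
    simp only [hLdef, h1]
  obtain ⟨E, hunion, hunique, hlabel, hrel, hclosed⟩ := exists_labelled_classes
    hA.countable_jointSpectrum s (fun a b hab ha => mem_of_reflTransGen_resonanceLink ha hab) L hLs
  have hEΛ : ∀ M j, E M j ⊆ Λ := fun M j a ha => by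
    rw [hΛ, ← hunion]; exact Set.mem_iUnion₂.mpr ⟨M, j, ha⟩
  refine ⟨E, hunion, ?_, ?_, ?_, ?_, ?_, ?_⟩
  · intro M j M' j' hne
    exact Set.disjoint_left.mpr fun a ha ha' => hne (hunique M j M' j' a ha ha')
  -- If `R' ≤ ‖b‖`, confinement from `b` applies. Otherwise confinement from `a` forces `‖a‖ ≤ 2
  -- R'`, and `2 ≤ ‖b‖` unless `a = b`.
  · refine ⟨2 + R', by linarith, fun M j a ha b hb => ?_⟩
    have hab := hrel M j a ha b hb
    have haΛ := hEΛ M j ha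
    have hbΛ := hEΛ M j hb
    by_cases hb' : R' ≤ ‖b‖
    · have h1 := hconf b hbΛ hb' a (s.symm hab)
      have h2 := norm_le_norm_add_norm_sub' a b
      nlinarith [norm_nonneg b]
    rcases Relation.ReflTransGen.cases_tail hab with rfl | ⟨c, -, hc⟩
    · nlinarith [norm_nonneg b]
    have hb2 := two_le_norm_of_resonanceLink hμh hR.le hc
    have ha' : ‖a‖ ≤ 2 * R' := by
      by_contra! ha'
      have h1 := hconf a haΛ (by linarith) b hab
      have h2 := norm_le_norm_add_norm_sub b a
      linarith
    nlinarith
  · intro M j hM a ha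
    have h1 := hlabel M j a ha
    by_cases h2 : ∀ b, s a b → ∃ k, IsResonant h δ μ R b k
    · obtain ⟨k, hk⟩ := h2 a (s.refl a)
      rw [hLdef] at h1
      simp only [if_pos h2] at h1
      exact ⟨k, h1 ▸ LatticeModule.subset_saturation _ ⟨a, s.refl a, hk⟩, hk⟩
    · rw [hLdef] at h1
      simp only [if_neg h2] at h1
      rw [← h1, LatticeModule.dim_saturation_empty] at hM
      omega
  · rintro M j hM ⟨a, ha⟩
    have h1 := hlabel M j a ha
    by_cases h2 : ∀ b, s a b → ∃ k, IsResonant h δ μ R b k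
    · rw [hLdef] at h1
      simp only [if_pos h2] at h1
      obtain ⟨k, hk⟩ := h2 a (s.refl a)
      have h3 : 1 ≤ M.dim := h1 ▸ LatticeModule.one_le_dim_saturation ⟨a, s.refl a, hk⟩ hk.ne_zero
      omega
    · push Not at h2
      obtain ⟨b, hab, hb⟩ := h2
      exact ⟨b, hclosed M j a ha b hab, hb⟩
  · intro M j a ha k hk hak
    refine hclosed M j a ha _ (Relation.ReflTransGen.single ⟨hEΛ M j ha, hak, k, ?_, .inl hk⟩)
    exact add_sub_cancel_left _ _
  · obtain ⟨K, hK, hsep⟩ := exists_separation hA hμ R hsep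
    refine ⟨K, hK, fun M j M' j' hne a ha b hb => ?_⟩
    have hnot : ¬ s a b := fun hab => hne (hunique M j M' j' b (hclosed M j a ha b hab) hb)
    have hab : a ≠ b := fun hab => hnot (hab ▸ s.refl a)
    have haΛ := hEΛ M j ha
    have hbΛ := hEΛ M' j' hb
    rcases le_total ‖b‖ ‖a‖ with hle | hle
    · exact hsep a haΛ b hbΛ hab hle fun h => hnot (Relation.ReflTransGen.single h)
    · have h1 := hsep b hbΛ a haΛ hab.symm hle
        fun h => hnot (s.symm (Relation.ReflTransGen.single h))
      rwa [norm_sub_rev, abs_sub_comm, add_comm (‖b‖ ^ μ)] at h1
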